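/- Let $\Sigma$ and $\tilde\Sigma$ be positive definite real symmetric $d\times d$ matrices. Write $N_d(\cdot;\mu,\Sigma)$ for the density of the normal distribution on $\mathbb R^d$ with mean $\mu$ and covariance matrix $\Sigma$. For a prior density $\pi:\mathbb R^d\to[0,\infty]$, not identically $0$ and possibly improper, let $$p_\pi(\tilde y\mid y)=\frac{\int N_d(\tilde y;\mu,\tilde\Sigma)\,N_d(y;\mu,\Sigma)\,\pi(\mu)\,d\mu}{\int N_d(y;\mu,\Sigma)\,\pi(\mu)\,d\mu}$$ be the Bayesian predictive density, and let $$R_{\rm KL}(\pi,\mu)=\int N_d(y;\mu,\Sigma)\int N_d(\tilde y;\mu,\tilde\Sigma)\log\frac{N_d(\tilde y;\mu,\tilde\Sigma)}{p_\pi(\tilde y\mid y)}\,d\tilde y\,dy$$ be its Kullback--Leibler risk. Let $\pi_I\equiv 1$ be the uniform prior. Put $\Sigma_w=(\Sigma^{-1}+\tilde\Sigma^{-1})^{-1}$, let $\Sigma_w^{1/2}\Sigma^{-1}\Sigma_w^{1/2}=U^\top\Lambda U$ be any diagonalization with $U$ orthogonal and $\Lambda$ diagonal, and let $$A^*=\Sigma_w^{1/2}U^\top(\Lambda^{-1}-I_d)^{1/2}.$$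 An extended real-valued function $f$ on $\mathbb R^d$ is called superharmonic if (1) $-\infty<f\le\infty$ and $f\not\equiv\infty$; (2) $f$ is lower semicontinuous; (3) whenever $G\subset\mathbb R^d$ is open with compact closure, $w$ is continuous on $\overline G$ and harmonic on $G$, and $f\ge w$ on $\partial G$, then $f\ge w$ on $G$. **Theorem.** Suppose that $\mu\mapsto\pi(A^*\mu)$ is superharmonic on $\mathbb R^d$. Then $R_{\rm KL}(\pi,\mu)\le R_{\rm KL}(\pi_I,\mu)$ for every $\mu\in\mathbb R^d$. If moreover $\pi$ is not a constant function, then $p_\pi$ dominates $p_{\pi_I}$, that is, in addition $R_{\rm KL}(\pi,\mu)<R_{\rm KL}(\pi_I,\mu)$ for some $\mu\in\mathbb R^d$. (The prior $\pi$ is allowed to depend on $\Sigma$ and $\tilde\Sigma$.) -/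

import Mathlib

open MeasureTheory Matrix
open scoped ENNReal

noncomputable section

namespace NormalPrediction

/-- An extended real-valued function `f` on an open set `R` of `ℝᵈ` is superharmonic: it never
takes the value `-∞`, it is not identically `+∞` on any connected component of `R`, it is lower
semicontinuous, and it lies above every harmonic function on a relatively compact open subset
that it dominates on the boundary. -/
structure IsSuperharmonicOn {d : ℕ} (f : EuclideanSpace ℝ (Fin d) → EReal)
    (R : Set (EuclideanSpace ℝ (Fin d))) : Prop where
  ne_bot : ∀ x ∈ R, f x ≠ ⊥
  not_top_on_component : ∀ x ∈ R, ∃ y ∈ connectedComponentIn R x, f y ≠ ⊤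
  lowerSemicontinuousOn : LowerSemicontinuousOn f R
  ge_harmonic : ∀ G : Set (EuclideanSpace ℝ (Fin d)), IsOpen G → IsCompact (closure G) →
    closure G ⊆ R → ∀ w : EuclideanSpace ℝ (Fin d) → ℝ, ContinuousOn w (closure G) →
      InnerProductSpace.HarmonicOnNhd w G → (∀ x ∈ frontier G, (w x : EReal) ≤ f x) →
        ∀ x ∈ G, (w x : EReal) ≤ f x

/-- The density `N_d(y; μ, S)` at `y` of the normal distribution with mean `μ` and (positive
definite) covariance matrix `S`, with respect to Lebesgue measure on `ℝᵈ`. -/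
def normalDensity {d : ℕ} (μ : EuclideanSpace ℝ (Fin d)) (S : Matrix (Fin d) (Fin d) ℝ)
    (y : EuclideanSpace ℝ (Fin d)) : ℝ≥0∞ :=
  ENNReal.ofReal
    (1 / ((2 * Real.pi) ^ ((d : ℝ) / 2) * Real.sqrt S.det) *
      Real.exp (-((y - μ).ofLp ⬝ᵥ (S⁻¹ *ᵥ (y - μ).ofLp)) / 2))

/-- The Kullback-Leibler loss `∫ p log (p / q)` between the probability laws with Lebesgue
densities `p` and `q`; it is `∞` when the integral diverges. -/
def klLoss {d : ℕ} (p q : EuclideanSpace ℝ (Fin d) → ℝ≥0∞) : ℝ≥0∞ :=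
  InformationTheory.klDiv (volume.withDensity p) (volume.withDensity q)

/-- The Kullback-Leibler risk at `μ` of a predictive density `phat y ·` of a future observation
`N_d(μ, S')`, built from an observation `y` with law `N_d(μ, S)`. -/
def klRisk {d : ℕ} (S S' : Matrix (Fin d) (Fin d) ℝ)
    (phat : EuclideanSpace ℝ (Fin d) → EuclideanSpace ℝ (Fin d) → ℝ≥0∞)
    (μ : EuclideanSpace ℝ (Fin d)) : ℝ≥0∞ :=
  ∫⁻ y, normalDensity μ S y * klLoss (normalDensity μ S') (phat y)

/-- The Bayesian predictive density at `y'` given `y`, for the (possibly improper) prior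
density `π` of the mean. -/
def bayesPredictive {d : ℕ} (S S' : Matrix (Fin d) (Fin d) ℝ)
    (π : EuclideanSpace ℝ (Fin d) → ℝ≥0∞) (y y' : EuclideanSpace ℝ (Fin d)) : ℝ≥0∞ :=
  (∫⁻ μ, normalDensity μ S' y' * normalDensity μ S y * π μ) /
    ∫⁻ μ, normalDensity μ S y * π μ

/-- The uniform prior. -/
def uniformPrior {d : ℕ} : EuclideanSpace ℝ (Fin d) → ℝ≥0∞ := fun _ => 1

/-- The predictive density `p` dominates the predictive density `q`: its risk is nowhere larger
and somewhere strictly smaller. -/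
def Dominates {d : ℕ} (S S' : Matrix (Fin d) (Fin d) ℝ)
    (p q : EuclideanSpace ℝ (Fin d) → EuclideanSpace ℝ (Fin d) → ℝ≥0∞) : Prop :=
  (∀ μ, klRisk S S' p μ ≤ klRisk S S' q μ) ∧ ∃ μ, klRisk S S' p μ < klRisk S S' q μ

/-- The matrix `(S⁻¹ + S'⁻¹)⁻¹`. -/
def sigmaW {d : ℕ} (S S' : Matrix (Fin d) (Fin d) ℝ) : Matrix (Fin d) (Fin d) ℝ :=
  (S⁻¹ + S'⁻¹)⁻¹

open scoped MatrixOrder in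
/-- The positive semidefinite square root of a positive semidefinite matrix. -/
def psdSqrt {d : ℕ} (M : Matrix (Fin d) (Fin d) ℝ) : Matrix (Fin d) (Fin d) ℝ := CFC.sqrt M

/-- `Uᵀ * diag(lam) * U` is a diagonalization of `S₁^{1/2} S₂⁻¹ S₁^{1/2}` by an orthogonal
matrix `U`. -/
def IsDiagonalization {d : ℕ} (S₁ S₂ U : Matrix (Fin d) (Fin d) ℝ) (lam : Fin d → ℝ) : Prop :=
  U ∈ Matrix.orthogonalGroup (Fin d) ℝ ∧
    psdSqrt S₁ * S₂⁻¹ * psdSqrt S₁ = Uᵀ * Matrix.diagonal lam * U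

/-- The matrix `S₁^{1/2} Uᵀ (Λ⁻¹ - I)^{1/2}` with `Λ = diag(lam)`. -/
def aStar {d : ℕ} (S₁ U : Matrix (Fin d) (Fin d) ℝ) (lam : Fin d → ℝ) :
    Matrix (Fin d) (Fin d) ℝ :=
  psdSqrt S₁ * Uᵀ * Matrix.diagonal fun i => Real.sqrt ((lam i)⁻¹ - 1)

end NormalPrediction

end

namespace NormalPrediction

open ProbabilityTheory Filter Topology

/-! ### Gaussian laws on Euclidean space: convolution, densities, averages of a prior -/

section Gaussian

variable {d : ℕ}

/-! Write W for `sigmaW S S'` and m_T for `gaussAvg T π`, the average of the prior over N(·, T).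
Completing the square in the product of the two sampling densities gives p_π(y' | y) = N(y'; y, S +
S') m_W(z) / m_S(y), where z is the precision-weighted mean of y and y'. If y and y' are independent
with mean μ, then z has law N(μ, W). Hence the risk of p_π is a term free of π, minus E log m_W(Z),
plus E log m_S(Y), with Z ~ N(μ, W) and Y ~ N(μ, S) (`klRisk_bayesPredictive`). For the uniform
prior both logarithms vanish, so everything reduces to E log m_S(Y) ≤ E log m_W(Z).

The matrix A* satisfies A* A*ᵀ = S - W =: B, which is positive definite (`aStar_mul_transpose`).
Superharmonicity of π ∘ A* therefore says that averaging π over N(0, tB) never increases it, for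
every t > 0 (`gaussAvg_smul_le_of_isSuperharmonicOn`). Realize Y as Z + ξ with ξ ~ N(0, B)
independent of Z. Given Z, the mean of m_S(Z + ξ) is m_{W+2B}(Z), the W-average of the 2B-average of
π, hence at most m_W(Z). So the ratio m_S(Y)/m_W(Z) has mean at most 1, and log t ≤ t - 1 finishes
the comparison (`lintegral_gaussAvg_div_le`, `logAvg_comparison`). No differentiation in the
covariance is needed.

If equality holds at one μ, the ratio is almost surely 1. Since ξ has full support given Z, m_S and
m_W are then almost everywhere the same constant c. This forces π to be almost everywhere invariant
under B-averaging; averaging often enough to pass through m_S gives π = c almost everywhere, and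
lower semicontinuity with the mean inequality gives it everywhere. Thus a nonconstant prior has
strictly smaller risk at every μ; the proof uses μ = 0.

The analytic input is that a nonnegative function g, superharmonic in the sense of comparison with
harmonic functions, dominates its isotropic Gaussian averages (`gaussAvg_le_of_isSuperharmonicOn`).
It is proved by an Euler scheme for the heat flow. If a smoothed minorant v lies below g, comparison
on a small sphere with a harmonic quadratic polynomial shows that v advanced by heat time s is still
a minorant, up to O(s^{3/2}). With T/s steps the total error is O(√s), which tends to 0. -/

theorem multivariateGaussian_map_toEuclideanLin (A : Matrix (Fin d) (Fin d) ℝ)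
    (μ : EuclideanSpace ℝ (Fin d)) {S : Matrix (Fin d) (Fin d) ℝ} (hS : S.PosSemidef) :
    (multivariateGaussian μ S).map (toEuclideanLin A) =
      multivariateGaussian (toEuclideanLin A μ) (A * S * Aᵀ) := by
  have hT : (A * S * Aᵀ).PosSemidef := by
    have := hS.mul_mul_conjTranspose_same A
    simpa [conjTranspose_eq_transpose_of_trivial] using this
  have hm : Measurable (toEuclideanLin A : EuclideanSpace ℝ (Fin d) → EuclideanSpace ℝ (Fin d)) :=
    (LinearMap.continuous_of_finiteDimensional _).measurable
  have : IsProbabilityMeasure ((multivariateGaussian μ S).map (toEuclideanLin A)) :=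
    Measure.isProbabilityMeasure_map hm.aemeasurable
  apply Measure.ext_of_charFun
  ext t
  have key : ∀ x : EuclideanSpace ℝ (Fin d),
      inner ℝ (toEuclideanLin A x) t = inner ℝ x (toEuclideanLin Aᵀ t) := by
    intro x
    simp only [EuclideanSpace.inner_eq_star_dotProduct, toLpLin_apply, star_trivial]
    rw [dotProduct_mulVec, mulVec_transpose]
  have h1 : charFun ((multivariateGaussian μ S).map (toEuclideanLin A)) t =
      charFun (multivariateGaussian μ S) (toEuclideanLin Aᵀ t) := by
    rw [charFun_apply, charFun_apply, integral_map hm.aemeasurable (by fun_prop)]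
    simp_rw [key]
  rw [h1, charFun_multivariateGaussian hS, charFun_multivariateGaussian hT,
    real_inner_comm, real_inner_comm _ t, key]
  congr 4
  simp only [toLpLin_apply]
  simp only [← mulVec_mulVec]
  rw [dotProduct_comm, dotProduct_mulVec, vecMul_transpose, dotProduct_comm]

theorem multivariateGaussian_conv (μ ν : EuclideanSpace ℝ (Fin d)) {S T : Matrix (Fin d) (Fin d) ℝ}
    (hS : S.PosSemidef) (hT : T.PosSemidef) :
    multivariateGaussian μ S ∗ multivariateGaussian ν T =
      multivariateGaussian (μ + ν) (S + T) := by
  apply Measure.ext_of_charFun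
  ext t
  rw [charFun_conv, charFun_multivariateGaussian hS, charFun_multivariateGaussian hT,
    charFun_multivariateGaussian (hS.add hT), ← Complex.exp_add]
  congr 1
  simp only [add_mulVec, dotProduct_add, inner_add_right]
  push_cast
  ring

theorem multivariateGaussian_eq_map_const_add (μ : EuclideanSpace ℝ (Fin d))
    {S : Matrix (Fin d) (Fin d) ℝ} :
    multivariateGaussian μ S = (multivariateGaussian 0 S).map (fun x => μ + x) := by
  simp only [multivariateGaussian]
  rw [Measure.map_map (by fun_prop) (by fun_prop)]
  congr 1
  ext x : 1
  simp

theorem stdGaussian_eq_withDensity :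
    stdGaussian (EuclideanSpace ℝ (Fin d)) = volume.withDensity (normalDensity 0 1) := by
  have hm : Measurable (normalDensity (0 : EuclideanSpace ℝ (Fin d)) 1) := by
    unfold normalDensity
    fun_prop
  have hdens : ∀ x : EuclideanSpace ℝ (Fin d), (normalDensity 0 1 x).toReal =
      1 / ((2 * Real.pi) ^ ((d : ℝ) / 2)) * Real.exp (-(1 / 2) * ‖x‖ ^ 2) := by
    intro x
    rw [normalDensity, ENNReal.toReal_ofReal (by positivity)]
    congr 1
    · simp
    · congr 1
      rw [EuclideanSpace.real_norm_sq_eq]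
      simp [dotProduct, pow_two]
      ring
  -- Uniqueness of characteristic functions is available for finite measures only, so finiteness
  -- comes before the total mass is known.
  have hfin : IsFiniteMeasure (volume.withDensity
      (normalDensity (0 : EuclideanSpace ℝ (Fin d)) 1)) := by
    have h := (GaussianFourier.integrable_cexp_neg_mul_sq_norm_add
      (V := EuclideanSpace ℝ (Fin d)) (b := 1 / 2) (by norm_num) 0 0).norm
    have h2 : Integrable fun x : EuclideanSpace ℝ (Fin d) => (normalDensity 0 1 x).toReal := by
      simp_rw [hdens]
      refine (h.congr (ae_of_all _ fun x => ?_)).const_mul _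
      beta_reduce
      rw [Complex.norm_exp]
      congr 1
      simp [← Complex.ofReal_pow]
    refine isFiniteMeasure_withDensity ?_
    have h3 := h2.lintegral_lt_top
    simp only [normalDensity] at h3 ⊢
    refine ne_of_lt (lt_of_le_of_lt (lintegral_mono fun x => ?_) h3)
    rw [ENNReal.ofReal_toReal ENNReal.ofReal_ne_top]
  apply Measure.ext_of_charFun
  ext t
  rw [charFun_stdGaussian, charFun_apply, integral_withDensity_eq_integral_toReal_smul hm
    (by simp [normalDensity])]
  simp_rw [hdens]
  have := GaussianFourier.integral_cexp_neg_mul_sq_norm_add (V := EuclideanSpace ℝ (Fin d))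
    (b := 1 / 2) (by norm_num) Complex.I t
  have h2 : ∀ x : EuclideanSpace ℝ (Fin d),
      (1 / (2 * Real.pi) ^ ((d : ℝ) / 2) * Real.exp (-(1 / 2) * ‖x‖ ^ 2)) •
        Complex.exp (inner ℝ x t * Complex.I) =
      ((1 / (2 * Real.pi) ^ ((d : ℝ) / 2) : ℝ) : ℂ) *
        Complex.exp (-(1 / 2) * ‖x‖ ^ 2 + Complex.I * inner ℝ t x) := by
    intro x
    rw [Complex.real_smul, Complex.exp_add, real_inner_comm, mul_comm Complex.I]
    push_cast
    ring
  simp_rw [h2]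
  rw [integral_const_mul, this]
  have h3 : ((Real.pi : ℂ) / (1 / 2)) ^ ((Module.finrank ℝ (EuclideanSpace ℝ (Fin d)) : ℂ) / 2) =
      (((2 * Real.pi) ^ ((d : ℝ) / 2) : ℝ) : ℂ) := by
    rw [Complex.ofReal_cpow (by positivity)]
    congr 1
    · push_cast; ring
    · simp
  rw [h3, ← mul_assoc, ← Complex.ofReal_mul, one_div_mul_cancel (by positivity)]
  simp only [Complex.I_sq, Complex.ofReal_one, one_mul]
  congr 1
  ring

theorem lintegral_comp_toEuclideanLin {A : Matrix (Fin d) (Fin d) ℝ} (hA : A.det ≠ 0)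
    {F : EuclideanSpace ℝ (Fin d) → ℝ≥0∞} (hF : Measurable F) :
    ∫⁻ x, F x = ENNReal.ofReal |A.det| * ∫⁻ x, F (toEuclideanLin A x) := by
  have hdet : LinearMap.det (toEuclideanLin A) = A.det := by
    rw [toEuclideanLin_eq_toLin_orthonormal, LinearMap.det_toLin]
  have hm : Measurable (toEuclideanLin A : EuclideanSpace ℝ (Fin d) → EuclideanSpace ℝ (Fin d)) :=
    (LinearMap.continuous_of_finiteDimensional _).measurable
  rw [← lintegral_map hF hm, Measure.map_linearMap_addHaar_eq_smul_addHaar _ (by rwa [hdet]),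
    lintegral_smul_measure, hdet, smul_eq_mul, ← mul_assoc, ← ENNReal.ofReal_mul (abs_nonneg _),
    ← abs_mul, mul_inv_cancel₀ hA]
  simp

theorem measurable_normalDensity (μ : EuclideanSpace ℝ (Fin d)) (S : Matrix (Fin d) (Fin d) ℝ) :
    Measurable (normalDensity μ S) := by
  unfold normalDensity
  fun_prop

theorem normalDensity_symm (S : Matrix (Fin d) (Fin d) ℝ) (x y : EuclideanSpace ℝ (Fin d)) :
    normalDensity x S y = normalDensity y S x := by
  rw [normalDensity, normalDensity, ← neg_sub x y, WithLp.ofLp_neg, mulVec_neg, neg_dotProduct_neg]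

theorem normalDensity_pos {S : Matrix (Fin d) (Fin d) ℝ} (hS : S.PosDef)
    (x y : EuclideanSpace ℝ (Fin d)) : 0 < normalDensity x S y := by
  have := hS.det_pos
  rw [normalDensity, ENNReal.ofReal_pos]
  positivity

theorem normalDensity_ne_top (S : Matrix (Fin d) (Fin d) ℝ) (x y : EuclideanSpace ℝ (Fin d)) :
    normalDensity x S y ≠ ∞ := ENNReal.ofReal_ne_top

/-- The law is the image of the standard one under x ↦ μ + S^{1/2} x, whose Jacobian |det S^{1/2}| =
√(det S) accounts for the normalizing constant. -/
theorem multivariateGaussian_eq_withDensity (μ : EuclideanSpace ℝ (Fin d))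
    {S : Matrix (Fin d) (Fin d) ℝ} (hS : S.PosDef) :
    multivariateGaussian μ S = volume.withDensity (normalDensity μ S) := by
  open scoped MatrixOrder in
  set R := CFC.sqrt S with hR
  have hRR : R * R = S := CFC.sqrt_mul_sqrt_self _ hS.posSemidef.nonneg
  have hdet : R.det * R.det = S.det := by rw [← det_mul, hRR]
  have hR0 : R.det ≠ 0 := by
    intro h
    have := hS.det_pos
    rw [← hdet, h] at this
    simp at this
  have hRT : Rᵀ = R := by
    have : R.IsHermitian := (CFC.sqrt_nonneg S).posSemidef.isHermitian
    simpa [conjTranspose_eq_transpose_of_trivial] using this.eq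
  have habs : |R.det| = Real.sqrt S.det := by rw [← hdet, Real.sqrt_mul_self_eq_abs]
  have hm : Measurable (toEuclideanLin R : EuclideanSpace ℝ (Fin d) → EuclideanSpace ℝ (Fin d)) :=
    (LinearMap.continuous_of_finiteDimensional _).measurable
  have hdens : ∀ x : EuclideanSpace ℝ (Fin d), normalDensity 0 1 x =
      ENNReal.ofReal |R.det| * normalDensity μ S (μ + toEuclideanLin R x) := by
    intro x
    rw [normalDensity, normalDensity, ← ENNReal.ofReal_mul (abs_nonneg _), ← mul_assoc]
    congr 2
    · rw [habs]
      have : 0 < Real.sqrt S.det := Real.sqrt_pos.2 hS.det_pos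
      have : 0 < (2 * Real.pi) ^ ((d : ℝ) / 2) := by positivity
      simp
      field_simp
    · congr 2
      have hq : R *ᵥ x.ofLp ⬝ᵥ (S⁻¹ *ᵥ (R *ᵥ x.ofLp)) = x.ofLp ⬝ᵥ x.ofLp := by
        have hRu : IsUnit R.det := isUnit_iff_ne_zero.2 hR0
        rw [← hRR, Matrix.mul_inv_rev, mulVec_mulVec, Matrix.mul_assoc, nonsing_inv_mul _ hRu,
          Matrix.mul_one]
        nth_rewrite 1 [← hRT]
        rw [mulVec_transpose, ← dotProduct_mulVec, mulVec_mulVec, mul_nonsing_inv _ hRu, one_mulVec]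
      simpa using hq.symm
  ext s hs
  rw [multivariateGaussian, Measure.map_apply (by fun_prop) hs, stdGaussian_eq_withDensity,
    withDensity_apply _ ((show Measurable _ by fun_prop) hs), withDensity_apply _ hs,
    ← lintegral_indicator hs, ← lintegral_indicator ((show Measurable _ by fun_prop) hs)]
  have hF : Measurable (s.indicator (normalDensity μ S)) :=
    (measurable_normalDensity μ S).indicator hs
  rw [← lintegral_add_left_eq_self (s.indicator (normalDensity μ S)) μ,
    lintegral_comp_toEuclideanLin hR0 (F := fun x => s.indicator (normalDensity μ S) (μ + x))
      (hF.comp (by fun_prop)), ← lintegral_const_mul _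
      (f := fun x => s.indicator (normalDensity μ S) (μ + toEuclideanLin R x))
      (hF.comp (hm.const_add μ))]
  congr 1
  ext x
  by_cases hx : μ + toEuclideanLin R x ∈ s
  · rw [Set.indicator_of_mem hx, Set.indicator_of_mem (by exact hx), hdens x]
  · rw [Set.indicator_of_notMem hx, Set.indicator_of_notMem (by exact hx), mul_zero]

/-- The average of `π` over the normal distribution with mean `y` and covariance matrix `S`. -/
noncomputable def gaussAvg (S : Matrix (Fin d) (Fin d) ℝ) (π : EuclideanSpace ℝ (Fin d) → ℝ≥0∞)
    (y : EuclideanSpace ℝ (Fin d)) : ℝ≥0∞ :=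
  ∫⁻ z, π (y + z) ∂(multivariateGaussian 0 S)

variable {S T : Matrix (Fin d) (Fin d) ℝ} {π : EuclideanSpace ℝ (Fin d) → ℝ≥0∞}

theorem measurable_gaussAvg (S : Matrix (Fin d) (Fin d) ℝ) (hπ : Measurable π) :
    Measurable (gaussAvg S π) :=
  Measurable.lintegral_prod_right' (f := fun p : _ × _ => π (p.1 + p.2)) (by fun_prop)

theorem gaussAvg_eq_lintegral (S : Matrix (Fin d) (Fin d) ℝ) (hπ : Measurable π)
    (y : EuclideanSpace ℝ (Fin d)) :
    gaussAvg S π y = ∫⁻ z, π z ∂(multivariateGaussian y S) := by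
  rw [multivariateGaussian_eq_map_const_add, lintegral_map hπ (by fun_prop), gaussAvg]

theorem gaussAvg_eq_lintegral_mul (hS : S.PosDef) (hπ : Measurable π)
    (y : EuclideanSpace ℝ (Fin d)) :
    gaussAvg S π y = ∫⁻ z, normalDensity y S z * π z := by
  rw [gaussAvg_eq_lintegral S hπ, multivariateGaussian_eq_withDensity y hS,
    lintegral_withDensity_eq_lintegral_mul _ (measurable_normalDensity y S) hπ]
  rfl

/-- The semigroup law: Gaussian convolution adds covariances. All later rearrangements of averages
rest on it. -/
theorem gaussAvg_gaussAvg (hS : S.PosSemidef) (hT : T.PosSemidef) (hπ : Measurable π) :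
    gaussAvg S (gaussAvg T π) = gaussAvg (S + T) π := by
  ext y
  have := multivariateGaussian_conv (0 : EuclideanSpace ℝ (Fin d)) 0 hS hT
  rw [add_zero] at this
  rw [gaussAvg, gaussAvg, ← this, Measure.lintegral_conv (by fun_prop)]
  simp only [gaussAvg, add_assoc]

theorem gaussAvg_mono (S : Matrix (Fin d) (Fin d) ℝ) {π₁ π₂ : EuclideanSpace ℝ (Fin d) → ℝ≥0∞}
    (h : ∀ x, π₁ x ≤ π₂ x) (y : EuclideanSpace ℝ (Fin d)) : gaussAvg S π₁ y ≤ gaussAvg S π₂ y :=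
  lintegral_mono fun _ => h _

theorem gaussAvg_const (S : Matrix (Fin d) (Fin d) ℝ) (c : ℝ≥0∞) (y : EuclideanSpace ℝ (Fin d)) :
    gaussAvg S (fun _ => c) y = c := by
  simp [gaussAvg]

theorem multivariateGaussian_absolutelyContinuous (y : EuclideanSpace ℝ (Fin d))
    (hS : S.PosDef) : multivariateGaussian y S ≪ volume := by
  rw [multivariateGaussian_eq_withDensity y hS]
  exact withDensity_absolutelyContinuous _ _

theorem volume_absolutelyContinuous_multivariateGaussian (y : EuclideanSpace ℝ (Fin d))
    (hS : S.PosDef) : volume ≪ multivariateGaussian y S := by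
  rw [multivariateGaussian_eq_withDensity y hS]
  exact withDensity_absolutelyContinuous' (measurable_normalDensity y S).aemeasurable
    (ae_of_all _ fun x => (normalDensity_pos hS y x).ne')

theorem gaussAvg_congr_ae (hS : S.PosDef) {π₁ π₂ : EuclideanSpace ℝ (Fin d) → ℝ≥0∞}
    (h₁ : Measurable π₁) (h₂ : Measurable π₂) (h : π₁ =ᵐ[volume] π₂) :
    gaussAvg S π₁ = gaussAvg S π₂ := by
  ext y
  rw [gaussAvg_eq_lintegral S h₁, gaussAvg_eq_lintegral S h₂]
  exact lintegral_congr_ae ((multivariateGaussian_absolutelyContinuous y hS).ae_le h)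

theorem gaussAvg_comp_toEuclideanLin (A : Matrix (Fin d) (Fin d) ℝ) (hS : S.PosSemidef)
    (hπ : Measurable π) (x : EuclideanSpace ℝ (Fin d)) :
    gaussAvg S (fun z => π (toEuclideanLin A z)) x =
      gaussAvg (A * S * Aᵀ) π (toEuclideanLin A x) := by
  have hm : Measurable (toEuclideanLin A : EuclideanSpace ℝ (Fin d) → EuclideanSpace ℝ (Fin d)) :=
    (LinearMap.continuous_of_finiteDimensional _).measurable
  have := multivariateGaussian_map_toEuclideanLin A 0 hS
  rw [map_zero] at this
  rw [gaussAvg, gaussAvg, ← this, lintegral_map (by fun_prop) hm]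
  simp only [map_add]

end Gaussian

/-! ### Comparison with harmonic quadratics, and Taylor bounds -/

section MeanInequality

variable {d : ℕ}

/-- The trace of a bilinear form in the standard basis. -/
noncomputable def bilinTrace
    (H : EuclideanSpace ℝ (Fin d) →L[ℝ] EuclideanSpace ℝ (Fin d) →L[ℝ] ℝ) : ℝ :=
  ∑ i, H (EuclideanSpace.single i 1) (EuclideanSpace.single i 1)

theorem harmonicOnNhd_quadratic (a : ℝ) (x : EuclideanSpace ℝ (Fin d))
    (p : EuclideanSpace ℝ (Fin d) →L[ℝ] ℝ)
    (H : EuclideanSpace ℝ (Fin d) →L[ℝ] EuclideanSpace ℝ (Fin d) →L[ℝ] ℝ)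
    (hH : bilinTrace H = 0)
    (G : Set (EuclideanSpace ℝ (Fin d))) :
    InnerProductSpace.HarmonicOnNhd (fun y => a + p (y - x) + H (y - x) (y - x)) G := by
  have h1 : ∀ y, HasFDerivAt (fun y => a + p (y - x) + H (y - x) (y - x))
      (p + (H (y - x) + H.flip (y - x))) y := by
    intro y
    have hs : HasFDerivAt (fun y => y - x) (ContinuousLinearMap.id ℝ _) y :=
      (hasFDerivAt_id y).sub_const x
    have hp := (p.hasFDerivAt (x := y - x)).comp y hs
    have hq := (H.hasFDerivAt (x := y - x)).comp y hs
    have := ((hp.const_add a)).add (hq.clm_apply hs)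
    convert! this using 1
  have h2 : fderiv ℝ (fun y => a + p (y - x) + H (y - x) (y - x)) =
      fun y => p + (H (y - x) + H.flip (y - x)) := funext fun y => (h1 y).fderiv
  have h3 : ∀ y, fderiv ℝ (fderiv ℝ (fun y => a + p (y - x) + H (y - x) (y - x))) y =
      H + H.flip := by
    intro y
    rw [h2]
    have hs : HasFDerivAt (fun y => y - x) (ContinuousLinearMap.id ℝ _) y :=
      (hasFDerivAt_id y).sub_const x
    have hq := ((H.hasFDerivAt (x := y - x)).comp y hs).add
      ((H.flip.hasFDerivAt (x := y - x)).comp y hs)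
    simpa using (hq.const_add p).fderiv
  intro y _
  refine ⟨by fun_prop, .of_forall fun z => ?_⟩
  rw [InnerProductSpace.laplacian_eq_iteratedFDeriv_orthonormalBasis _
    (EuclideanSpace.basisFun (Fin d) ℝ)]
  rw [bilinTrace] at hH
  simp only [iteratedFDeriv_two_apply, h3]
  simp [Finset.sum_add_distrib, hH]

/-- Replacing H by its trace-free part makes the Taylor polynomial harmonic. On the sphere of
squared radius d s the removed multiple of ‖y‖² is the constant s tr H, so it can be moved into the
constant term, where it becomes a gain at the centre. This gain equals the mean of H(z, z) for z ~
N(0, sI), so the bound tracks a heat step of length s. -/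
theorem IsSuperharmonicOn.le_of_taylor_le {f : EuclideanSpace ℝ (Fin d) → EReal}
    (hf : IsSuperharmonicOn f Set.univ) (hd : d ≠ 0) {v : EuclideanSpace ℝ (Fin d) → ℝ}
    (hv : ∀ y, (v y : EReal) ≤ f y) (x : EuclideanSpace ℝ (Fin d))
    (p : EuclideanSpace ℝ (Fin d) →L[ℝ] ℝ)
    (H : EuclideanSpace ℝ (Fin d) →L[ℝ] EuclideanSpace ℝ (Fin d) →L[ℝ] ℝ) {C s : ℝ}
    (hT : ∀ y, v x + p y + H y y - C * ‖y‖ ^ 3 ≤ v (x + y)) (hs : 0 < s) :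
    ((v x + s * bilinTrace H - C * √(d * s) ^ 3 : ℝ) : EReal) ≤ f x := by
  set τ := bilinTrace H with hτ
  set D := (isBoundedBilinearMap_inner (𝕜 := ℝ)
    (E := EuclideanSpace ℝ (Fin d))).toContinuousLinearMap
  have hD : ∀ u v, D u v = inner ℝ u v := fun _ _ => rfl
  have hd' : (0 : ℝ) < d := by positivity
  set r := √(d * s) with hr
  have hr0 : 0 < r := Real.sqrt_pos.2 (by positivity)
  have hr2 : r ^ 2 = d * s := Real.sq_sqrt (by positivity)
  set a := v x + s * τ - C * r ^ 3 with ha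
  set H' := H - (τ / d) • D with hH'
  have htr : bilinTrace H' = 0 := by
    rw [bilinTrace] at hτ ⊢
    simp only [hH', _root_.sub_apply, _root_.smul_apply,
      Finset.sum_sub_distrib, ← hτ, hD]
    simp
    field_simp
    simp
  have hw := harmonicOnNhd_quadratic a x p H' htr (Metric.ball x r)
  have hcont : Continuous (fun y => a + p (y - x) + H' (y - x) (y - x)) := by fun_prop
  have := hf.ge_harmonic (Metric.ball x r) Metric.isOpen_ball
    (by rw [closure_ball x hr0.ne']; exact isCompact_closedBall x r) (Set.subset_univ _)
    (fun y => a + p (y - x) + H' (y - x) (y - x)) hcont.continuousOn hw ?_ x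
    (Metric.mem_ball_self hr0)
  · simpa using this
  · intro y hy
    rw [frontier_ball x hr0.ne', mem_sphere_iff_norm] at hy
    refine le_trans ?_ (hv y)
    have h1 := hT (y - x)
    rw [add_sub_cancel, hy] at h1
    rw [EReal.coe_le_coe_iff]
    refine le_trans (le_of_eq ?_) h1
    have h2 : H' (y - x) (y - x) = H (y - x) (y - x) - s * τ := by
      simp only [hH', _root_.sub_apply, _root_.smul_apply,
        hD, real_inner_self_eq_norm_sq, hy, hr2, smul_eq_mul]
      field_simp
    rw [h2, ha]
    ring

/-- The mean value inequality is used twice on the ball of radius ‖y‖: for the first derivative,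
then for the function minus its quadratic part. This loses the sharp constant but needs no integral
remainder. -/
theorem abs_sub_taylor_le {E : Type*} [NormedAddCommGroup E] [NormedSpace ℝ E] {φ : E → ℝ}
    {p : E → E →L[ℝ] ℝ} {B : E → E →L[ℝ] E →L[ℝ] ℝ} (hp : ∀ x, HasFDerivAt φ (p x) x)
    (hB : ∀ x, HasFDerivAt p (B x) x) (hsymm : ∀ x u v, B x u v = B x v u) {L : ℝ} (hL0 : 0 ≤ L)
    (hL : ∀ x y, ‖B x - B y‖ ≤ L * ‖x - y‖) (x y : E) :
    |φ (x + y) - φ x - p x y - ((1 / 2 : ℝ) • B x) y y| ≤ L * ‖y‖ ^ 3 := by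
  have h1 : ∀ z ∈ Metric.closedBall x ‖y‖,
      ‖p z - p x - B x (z - x)‖ ≤ L * ‖y‖ * ‖y‖ := by
    intro z hz
    have hz' : ‖z - x‖ ≤ ‖y‖ := by simpa [dist_eq_norm] using hz
    have := (convex_closedBall x ‖y‖).norm_image_sub_le_of_norm_hasFDerivWithin_le'
      (f := p) (f' := B) (φ := B x) (C := L * ‖y‖) (x := x) (y := z)
      (fun w _ => (hB w).hasFDerivWithinAt) (fun w hw => ?_) (by simp) hz
    · exact this.trans (by gcongr)
    · have : ‖w - x‖ ≤ ‖y‖ := by simpa [dist_eq_norm] using hw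
      exact (hL w x).trans (by gcongr)
  have h3 : ∀ w, HasFDerivAt (fun z => φ z - (1 / 2 : ℝ) * B x (z - x) (z - x))
      (p w - B x (w - x)) w := by
    intro w
    have hs : HasFDerivAt (fun y => y - x) (ContinuousLinearMap.id ℝ E) w :=
      (hasFDerivAt_id w).sub_const x
    have hq := (((B x).hasFDerivAt (x := w - x)).comp w hs).clm_apply hs
    have := (hp w).sub (hq.const_mul (1 / 2 : ℝ))
    refine this.congr_fderiv ?_
    ext v
    simp [hsymm x v w, hsymm x v x]
    ring
  have h2 := (convex_closedBall x ‖y‖).norm_image_sub_le_of_norm_hasFDerivWithin_le'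
      (f := fun z => φ z - (1 / 2 : ℝ) * B x (z - x) (z - x))
      (f' := fun z => p z - B x (z - x)) (φ := p x) (C := L * ‖y‖ * ‖y‖)
      (x := x) (y := x + y) (fun w _ => (h3 w).hasFDerivWithinAt) (fun w hw => ?_)
      (by simp) (by simp)
  · simp only [add_sub_cancel_left, sub_self, map_zero, mul_zero, sub_zero, Real.norm_eq_abs] at h2
    calc |φ (x + y) - φ x - p x y - ((1 / 2 : ℝ) • B x) y y|
        = |φ (x + y) - 1 / 2 * B x y y - φ x - p x y| := by
          congr 1
          simp
          ring
      _ ≤ L * ‖y‖ * ‖y‖ * ‖y‖ := h2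
      _ = L * ‖y‖ ^ 3 := by ring
  · rw [sub_right_comm]
    exact h1 w hw

theorem exists_taylor_bound {E : Type*} [NormedAddCommGroup E] [NormedSpace ℝ E] {φ : E → ℝ}
    (hφ : ContDiff ℝ 3 φ) (hc : HasCompactSupport φ) :
    ∃ (p : E → E →L[ℝ] ℝ) (H : E → E →L[ℝ] E →L[ℝ] ℝ) (C : ℝ), 0 ≤ C ∧
      Continuous p ∧ HasCompactSupport p ∧
      (∀ u v, Continuous fun x => H x u v) ∧ (∀ u v, HasCompactSupport fun x => H x u v) ∧
      ∀ x y, |φ (x + y) - φ x - p x y - H x y y| ≤ C * ‖y‖ ^ 3 := by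
  have hφ1 : ContDiff ℝ 2 (fderiv ℝ φ) := hφ.fderiv_right (by norm_num)
  have hφ2 : ContDiff ℝ 1 (fderiv ℝ (fderiv ℝ φ)) := hφ1.fderiv_right (by norm_num)
  have hc1 : HasCompactSupport (fderiv ℝ φ) := hc.fderiv ℝ
  have hc2 : HasCompactSupport (fderiv ℝ (fderiv ℝ φ)) := hc1.fderiv ℝ
  have hLip : ∃ L, LipschitzWith L (fderiv ℝ (fderiv ℝ φ)) :=
    ContDiff.lipschitzWith_of_hasCompactSupport (𝕂 := ℝ) (n := 1) hc2 hφ2 one_ne_zero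
  obtain ⟨L, hL⟩ := hLip
  have hc3 : ∀ u v, HasCompactSupport (fun x => ((1 / 2 : ℝ) • fderiv ℝ (fderiv ℝ φ) x) u v) :=
    fun u v => hc2.comp_left (g := fun B : E →L[ℝ] E →L[ℝ] ℝ => ((1 / 2 : ℝ) • B) u v) (by simp)
  have hp : ∀ x, HasFDerivAt φ (fderiv ℝ φ x) x :=
    fun x => ((hφ.differentiable (by norm_num)) x).hasFDerivAt
  have hB : ∀ x, HasFDerivAt (fderiv ℝ φ) (fderiv ℝ (fderiv ℝ φ) x) x :=
    fun x => ((hφ1.differentiable (by norm_num)) x).hasFDerivAt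
  have hsymm : ∀ x u v, fderiv ℝ (fderiv ℝ φ) x u v = fderiv ℝ (fderiv ℝ φ) x v u := by
    intro x
    have h3 : minSmoothness ℝ 2 ≤ 3 := by
      rw [minSmoothness_of_isRCLikeNormedField]
      norm_num
    exact (hφ.contDiffAt (x := x)).isSymmSndFDerivAt h3
  have hL' : ∀ x y, ‖fderiv ℝ (fderiv ℝ φ) x - fderiv ℝ (fderiv ℝ φ) y‖ ≤ (L : ℝ) * ‖x - y‖ :=
    fun x y => hL.norm_sub_le x y
  have hT := abs_sub_taylor_le hp hB hsymm L.coe_nonneg hL'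
  have hcont : ∀ u v, Continuous fun x => ((1 / 2 : ℝ) • fderiv ℝ (fderiv ℝ φ) x) u v :=
    fun u v => ((hφ2.const_smul (1 / 2 : ℝ)).continuous.clm_apply continuous_const).clm_apply
      continuous_const
  exact ⟨fderiv ℝ φ, _, L, L.coe_nonneg, hφ1.continuous, hc1, hcont, hc3, hT⟩

end MeanInequality

/-! ### Moments of isotropic Gaussians -/

section GaussianMoments

variable {d : ℕ}

theorem integrable_norm_pow_multivariateGaussian (μ : EuclideanSpace ℝ (Fin d))
    (S : Matrix (Fin d) (Fin d) ℝ) (n : ℕ) :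
    Integrable (fun z => ‖z‖ ^ n) (multivariateGaussian μ S) := by
  simpa using (IsGaussian.memLp_id (multivariateGaussian μ S) (n : ℝ≥0∞) (by simp)).integrable_norm_pow'

theorem posSemidef_smul_one {t : ℝ} (ht : 0 ≤ t) :
    (t • (1 : Matrix (Fin d) (Fin d) ℝ)).PosSemidef :=
  PosSemidef.one.smul ht

theorem integral_comp_isotropicGaussian {F : Type*} [NormedAddCommGroup F] [NormedSpace ℝ F]
    {s : ℝ} (hs : 0 ≤ s) {g : EuclideanSpace ℝ (Fin d) → F} (hg : Continuous g) :
    ∫ z, g z ∂(multivariateGaussian 0 (s • 1)) = ∫ z, g (√s • z) ∂(multivariateGaussian 0 1) := by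
  have h := multivariateGaussian_map_toEuclideanLin (√s • (1 : Matrix (Fin d) (Fin d) ℝ)) 0
    PosSemidef.one
  have h2 : ∀ z, toEuclideanLin (√s • (1 : Matrix (Fin d) (Fin d) ℝ)) z = √s • z := by
    intro z
    ext i
    simp
  have h3 : (√s • (1 : Matrix (Fin d) (Fin d) ℝ)) * 1 * (√s • 1)ᵀ = s • 1 := by
    simp [smul_smul, Real.mul_self_sqrt hs]
  rw [map_zero, h3] at h
  rw [← h, integral_map ?_ hg.aestronglyMeasurable]
  · simp_rw [h2]
  · exact (LinearMap.continuous_of_finiteDimensional _).measurable.aemeasurable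

theorem integral_norm_cube_isotropicGaussian {s : ℝ} (hs : 0 ≤ s) :
    ∫ z : EuclideanSpace ℝ (Fin d), ‖z‖ ^ 3 ∂(multivariateGaussian 0 (s • 1)) =
      √s ^ 3 * ∫ z : EuclideanSpace ℝ (Fin d), ‖z‖ ^ 3 ∂(multivariateGaussian 0 1) := by
  rw [integral_comp_isotropicGaussian hs (by fun_prop), ← integral_const_mul]
  simp only [norm_smul, mul_pow, Real.norm_eq_abs, abs_of_nonneg (Real.sqrt_nonneg s)]

theorem integrable_bilin_multivariateGaussian (μ : EuclideanSpace ℝ (Fin d))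
    (S : Matrix (Fin d) (Fin d) ℝ)
    (H : EuclideanSpace ℝ (Fin d) →L[ℝ] EuclideanSpace ℝ (Fin d) →L[ℝ] ℝ) :
    Integrable (fun z => H z z) (multivariateGaussian μ S) := by
  refine ((integrable_norm_pow_multivariateGaussian μ S 2).const_mul ‖H‖).mono'
    (Continuous.aestronglyMeasurable (by fun_prop)) (ae_of_all _ fun z => ?_)
  rw [pow_two, ← mul_assoc]
  exact H.le_opNorm₂ z z

theorem integral_clm_multivariateGaussian_zero (S : Matrix (Fin d) (Fin d) ℝ)
    (p : EuclideanSpace ℝ (Fin d) →L[ℝ] ℝ) :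
    ∫ z, p z ∂(multivariateGaussian 0 S) = 0 := by
  rw [p.integral_comp_comm (φ := fun z => z) IsGaussian.integrable_id, integral_id_multivariateGaussian, map_zero]

/-- Expanding in coordinates, only the diagonal terms survive because the covariance is s times the
identity. -/
theorem integral_bilin_isotropicGaussian {s : ℝ} (hs : 0 ≤ s)
    (H : EuclideanSpace ℝ (Fin d) →L[ℝ] EuclideanSpace ℝ (Fin d) →L[ℝ] ℝ) :
    ∫ z, H z z ∂(multivariateGaussian 0 (s • 1)) = s * bilinTrace H := by
  have hexp : ∀ z : EuclideanSpace ℝ (Fin d), H z z =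
      ∑ i, ∑ j, (z i * z j) * H (EuclideanSpace.single i 1) (EuclideanSpace.single j 1) := by
    intro z
    have hz : z = ∑ i, z i • EuclideanSpace.single i (1 : ℝ) := by
      simpa using ((EuclideanSpace.basisFun (Fin d) ℝ).sum_repr z).symm
    conv_lhs => rw [hz]
    simp only [map_sum, ContinuousLinearMap.map_smul, _root_.sum_apply, _root_.smul_apply,
      smul_eq_mul, mul_assoc]
    rw [Finset.sum_comm]
  have hint : ∀ i j, Integrable (fun z : EuclideanSpace ℝ (Fin d) => z i * z j)
      (multivariateGaussian 0 (s • 1)) := by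
    intro i j
    refine ((integrable_norm_pow_multivariateGaussian 0 (s • 1) 2)).mono'
      (Continuous.aestronglyMeasurable (by fun_prop)) (ae_of_all _ fun z => ?_)
    rw [norm_mul, pow_two]
    exact mul_le_mul (PiLp.norm_apply_le z i) (PiLp.norm_apply_le z j) (norm_nonneg _)
      (norm_nonneg _)
  have hcov : ∀ i j, ∫ z : EuclideanSpace ℝ (Fin d), z i * z j ∂(multivariateGaussian 0 (s • 1)) =
      (s • (1 : Matrix (Fin d) (Fin d) ℝ)) i j := by
    intro i j
    have hmean : ∀ i, ∫ z : EuclideanSpace ℝ (Fin d), z i ∂(multivariateGaussian 0 (s • 1)) = 0 :=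
      fun i => integral_clm_multivariateGaussian_zero _ (EuclideanSpace.proj i)
    rw [← covariance_eval_multivariateGaussian (μ := 0) (posSemidef_smul_one hs) i j, covariance]
    simp [hmean]
  simp_rw [hexp]
  rw [integral_finsetSum _ fun i _ => integrable_finsetSum _ fun j _ => (hint i j).mul_const _]
  simp_rw [integral_finsetSum _ fun j _ => (hint _ j).mul_const _, integral_mul_const, hcov]
  rw [bilinTrace, Finset.mul_sum]
  refine Finset.sum_congr rfl fun i _ => ?_
  simp [Matrix.one_apply, Finset.sum_ite_eq]

theorem integral_le_of_le_taylor {s : ℝ} (hs : 0 ≤ s) {v : EuclideanSpace ℝ (Fin d) → ℝ}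
    {x : EuclideanSpace ℝ (Fin d)} {p : EuclideanSpace ℝ (Fin d) →L[ℝ] ℝ}
    {H : EuclideanSpace ℝ (Fin d) →L[ℝ] EuclideanSpace ℝ (Fin d) →L[ℝ] ℝ} {C : ℝ}
    (hT : ∀ y, v (x + y) ≤ v x + p y + H y y + C * ‖y‖ ^ 3)
    (hv : Integrable (fun z => v (x + z)) (multivariateGaussian 0 (s • 1))) :
    ∫ z, v (x + z) ∂(multivariateGaussian 0 (s • 1)) ≤ v x + s * bilinTrace H +
      C * (√s ^ 3 * ∫ z : EuclideanSpace ℝ (Fin d), ‖z‖ ^ 3 ∂(multivariateGaussian 0 1)) := by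
  have hp : Integrable (fun z => p z) (multivariateGaussian 0 (s • 1)) :=
    p.integrable_comp IsGaussian.integrable_id
  have hH := integrable_bilin_multivariateGaussian 0 (s • 1) H
  have hn := (integrable_norm_pow_multivariateGaussian (d := d) 0 (s • 1) 3).const_mul C
  have h1 : Integrable (fun z => v x + p z) (multivariateGaussian 0 (s • 1)) :=
    (integrable_const _).add hp
  have h2 : Integrable (fun z => v x + p z + H z z) (multivariateGaussian 0 (s • 1)) :=
    h1.add hH
  refine (integral_mono hv (h2.add hn) hT).trans (le_of_eq ?_)
  rw [integral_add' h2 hn, integral_add h1 hH, integral_add (integrable_const _) hp,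
    integral_clm_multivariateGaussian_zero, integral_bilin_isotropicGaussian hs,
    integral_const_mul, integral_norm_cube_isotropicGaussian hs]
  simp

theorem isotropicGaussian_conv {s t : ℝ} (hs : 0 ≤ s) (ht : 0 ≤ t) :
    multivariateGaussian (0 : EuclideanSpace ℝ (Fin d)) (s • 1) ∗
      multivariateGaussian 0 (t • 1) = multivariateGaussian 0 ((s + t) • 1) := by
  rw [multivariateGaussian_conv _ _ (posSemidef_smul_one hs) (posSemidef_smul_one ht), add_zero,
    add_smul]

end GaussianMoments

/-! ### Taylor bounds for averaged functions -/

section TaylorAverage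

theorem integrable_comp_const_add {E F : Type*} [NormedAddCommGroup E] [MeasurableSpace E]
    [BorelSpace E] [SecondCountableTopology E] [NormedAddCommGroup F] {g : E → F}
    (hg : Continuous g) (hc : HasCompactSupport g) (γ : Measure E) [IsProbabilityMeasure γ] (x : E) :
    Integrable (fun z => g (x + z)) γ := by
  obtain ⟨B, hB⟩ := hg.bounded_above_of_compact_support hc
  exact Integrable.of_bound ((hg.comp (by fun_prop)).aestronglyMeasurable) B
    (ae_of_all _ fun z => hB _)

/-- The order of quantifiers matters: C depends on φ alone, because averaging over a probability
measure preserves the pointwise remainder bound. The error of a heat step is thus uniform in the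
time already elapsed. -/
theorem exists_taylor_bound_average {E : Type*} [NormedAddCommGroup E] [NormedSpace ℝ E]
    [FiniteDimensional ℝ E] [MeasurableSpace E] [BorelSpace E] {φ : E → ℝ}
    (hφ : ContDiff ℝ 3 φ) (hc : HasCompactSupport φ) :
    ∃ C : ℝ, ∀ (γ : Measure E) [IsProbabilityMeasure γ] (x : E),
      ∃ (p : E →L[ℝ] ℝ) (H : E →L[ℝ] E →L[ℝ] ℝ), ∀ y,
        |∫ z, φ (x + y + z) ∂γ - ∫ z, φ (x + z) ∂γ - p y - H y y| ≤ C * ‖y‖ ^ 3 := by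
  have : ProperSpace E := FiniteDimensional.proper ℝ E
  obtain ⟨p, H, C, hC, hpc, hps, hHc, hHs, hT⟩ := exists_taylor_bound hφ hc
  refine ⟨C, fun γ _ x => ?_⟩
  have hpint := integrable_comp_const_add hpc hps γ x
  have hHint := fun u v => integrable_comp_const_add (hHc u v) (hHs u v) γ x
  have hint := integrable_comp_const_add hφ.continuous hc γ
  let B : E →ₗ[ℝ] E →ₗ[ℝ] ℝ := LinearMap.mk₂ ℝ (fun u v => ∫ z, H (x + z) u v ∂γ)
    (fun u u' v => by simp [integral_add (hHint u v) (hHint u' v)])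
    (fun c u v => by simp [integral_const_mul])
    (fun u v v' => by simp [integral_add (hHint u v) (hHint u v')])
    (fun c u v => by simp [integral_const_mul])
  refine ⟨∫ z, p (x + z) ∂γ, LinearMap.toContinuousBilinearMap B, fun y => ?_⟩
  have i1 := hpint.apply_continuousLinearMap y
  have i2 := hHint y y
  have e1 : (∫ z, p (x + z) ∂γ) y = ∫ z, p (x + z) y ∂γ :=
    ContinuousLinearMap.integral_apply hpint y
  have e2 : LinearMap.toContinuousBilinearMap B y y = ∫ z, H (x + z) y y ∂γ := rfl
  have i3 : Integrable (fun z => φ (x + y + z) - φ (x + z)) γ := (hint _).sub (hint _)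
  have i4 : Integrable (fun z => φ (x + y + z) - φ (x + z) - p (x + z) y) γ := i3.sub i1
  rw [e1, e2, ← integral_sub (hint _) (hint _), ← integral_sub i3 i1, ← integral_sub i4 i2,
    ← Real.norm_eq_abs]
  refine (norm_integral_le_of_norm_le_const (C := C * ‖y‖ ^ 3)
    (ae_of_all _ fun z => ?_)).trans (le_of_eq ?_)
  · rw [Real.norm_eq_abs, add_right_comm]
    exact hT (x + z) y
  · simp

end TaylorAverage

/-! ### One step of the heat flow below a superharmonic function -/

section SuperharmonicMean

variable {d : ℕ}

/-- The lower bound from harmonic comparison and the upper Taylor estimate of the Gaussian average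
share the term v(x) + s tr H, so they differ only by cubic remainders. K is independent of the
offset b, the step s and the time t, which permits iteration. -/
theorem IsSuperharmonicOn.integral_sub_le {f : EuclideanSpace ℝ (Fin d) → EReal}
    (hf : IsSuperharmonicOn f Set.univ) (hd : d ≠ 0) {φ : EuclideanSpace ℝ (Fin d) → ℝ}
    (hφ : ContDiff ℝ 3 φ) (hc : HasCompactSupport φ) :
    ∃ K : ℝ, ∀ (b s t : ℝ), 0 < s → 0 ≤ t →
      (∀ x, ((∫ z, φ (x + z) ∂(multivariateGaussian 0 (t • 1)) - b : ℝ) : EReal) ≤ f x) →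
      ∀ x, ((∫ z, φ (x + z) ∂(multivariateGaussian 0 ((s + t) • 1)) - b - K * √s ^ 3 : ℝ) : EReal)
        ≤ f x := by
  obtain ⟨C, hT⟩ := exists_taylor_bound_average hφ hc
  set M := ∫ z : EuclideanSpace ℝ (Fin d), ‖z‖ ^ 3 ∂(multivariateGaussian 0 1)
  -- M comes from the third absolute moment of the Gaussian, √d ^ 3 from the comparison radius √(d
  -- s).
  refine ⟨C * (M + √d ^ 3), fun b s t hs ht hle x => ?_⟩
  set γ := multivariateGaussian (0 : EuclideanSpace ℝ (Fin d)) (t • 1) with hγ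
  set v : EuclideanSpace ℝ (Fin d) → ℝ := fun x => ∫ z, φ (x + z) ∂γ with hv
  have hint : ∀ (ν : Measure (EuclideanSpace ℝ (Fin d))) [IsProbabilityMeasure ν]
      (x : EuclideanSpace ℝ (Fin d)), Integrable (fun z => φ (x + z)) ν :=
    fun ν _ x => integrable_comp_const_add hφ.continuous hc ν x
  obtain ⟨px, Hx, hvT'⟩ := hT γ x
  have hvT : ∀ y, |v (x + y) - v x - px y - Hx y y| ≤ C * ‖y‖ ^ 3 := hvT'
  have step := hf.le_of_taylor_le hd hle x px Hx (C := C) (s := s) (fun y => by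
    have := (abs_le.1 (hvT y)).1
    simp only [hv] at this
    linarith) hs
  have hconv : ∫ z, φ (x + z) ∂(multivariateGaussian 0 ((s + t) • 1)) =
      ∫ z, v (x + z) ∂(multivariateGaussian 0 (s • 1)) := by
    have : Integrable (fun z => φ (x + z)) (multivariateGaussian 0 (s • 1) ∗ γ) := hint _ x
    rw [← isotropicGaussian_conv hs.le ht, integral_conv this]
    simp only [hv, add_assoc]
  have hvcont : Integrable (fun z => v (x + z)) (multivariateGaussian 0 (s • 1)) := by
    have hvm : StronglyMeasurable v :=
      StronglyMeasurable.integral_prod_right' (f := fun q : _ × _ => φ (q.1 + q.2))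
        (hφ.continuous.comp (by fun_prop)).stronglyMeasurable
    obtain ⟨B, hB⟩ := hφ.continuous.bounded_above_of_compact_support hc
    refine Integrable.of_bound (hvm.comp_measurable (by fun_prop)).aestronglyMeasurable B
      (ae_of_all _ fun z => ?_)
    refine (norm_integral_le_of_norm_le_const (ae_of_all _ fun w => hB _)).trans (le_of_eq ?_)
    simp
  have hup := integral_le_of_le_taylor hs.le (v := v) (x := x) (p := px) (H := Hx) (C := C)
    (fun y => by have := (abs_le.1 (hvT y)).2; linarith) hvcont
  refine le_trans ?_ step
  rw [EReal.coe_le_coe_iff, hconv]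
  have : √(d * s) ^ 3 = √d ^ 3 * √s ^ 3 := by
    rw [Real.sqrt_mul (Nat.cast_nonneg d), mul_pow]
  rw [this]
  change _ ≤ v x - b + s * bilinTrace Hx - C * (√d ^ 3 * √s ^ 3)
  linarith

end SuperharmonicMean

/-! ### Superharmonic functions dominate their Gaussian averages -/

section SuperharmonicGaussian

variable {d : ℕ}

theorem multivariateGaussian_zero_cov (μ : EuclideanSpace ℝ (Fin d)) :
    multivariateGaussian μ 0 = Measure.dirac μ := by
  simp [multivariateGaussian]

theorem IsSuperharmonicOn.integral_smooth_sub_le {f : EuclideanSpace ℝ (Fin d) → EReal}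
    (hf : IsSuperharmonicOn f Set.univ) (hd : d ≠ 0) {φ : EuclideanSpace ℝ (Fin d) → ℝ}
    (hφ : ContDiff ℝ 3 φ) (hc : HasCompactSupport φ) {b T : ℝ} (hT : 0 < T)
    (hle : ∀ x, ((φ x - b : ℝ) : EReal) ≤ f x) (x : EuclideanSpace ℝ (Fin d)) :
    ((∫ z, φ (x + z) ∂(multivariateGaussian 0 (T • 1)) - b : ℝ) : EReal) ≤ f x := by
  obtain ⟨K, hK⟩ := hf.integral_sub_le hd hφ hc
  have hiter : ∀ (s : ℝ), 0 < s → ∀ k : ℕ, ∀ x,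
      ((∫ z, φ (x + z) ∂(multivariateGaussian 0 ((k * s) • 1)) - (b + k * (K * √s ^ 3)) : ℝ) :
        EReal) ≤ f x := by
    intro s hs k
    induction k with
    | zero =>
      intro x
      simpa [multivariateGaussian_zero_cov] using hle x
    | succ k ih =>
      intro x
      have := hK _ s (k * s) hs (by positivity) ih x
      have e1 : ((k + 1 : ℕ) : ℝ) * s = s + k * s := by push_cast; ring
      rw [e1]
      refine le_trans (le_of_eq ?_) this
      congr 1
      push_cast
      ring
  set I := ∫ z, φ (x + z) ∂(multivariateGaussian 0 (T • 1))
  -- With n steps of length T/n the accumulated error is n K (T/n)^{3/2} = K T √(T/n), which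
  -- vanishes as n grows.
  have hn : ∀ n : ℕ, 0 < n → ((I - (b + K * (T * √(T / n))) : ℝ) : EReal) ≤ f x := by
    intro n hn
    have hn' : (0 : ℝ) < n := by exact_mod_cast hn
    have := hiter (T / n) (by positivity) n x
    rw [mul_div_cancel₀ _ hn'.ne'] at this
    refine le_trans (le_of_eq ?_) this
    have e : √(T / n) ^ 3 = T / n * √(T / n) := by
      rw [pow_succ, Real.sq_sqrt (by positivity)]
    rw [e]
    congr 3
    field_simp
  have hlim : Tendsto (fun n : ℕ => I - (b + K * (T * √(T / n)))) atTop (𝓝 (I - b)) := by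
    have h1 : Tendsto (fun n : ℕ => √(T / n)) atTop (𝓝 0) := by
      have := (tendsto_const_div_atTop_nhds_zero_nat T).sqrt
      simpa using this
    have := ((h1.const_mul T).const_mul K).const_add b |>.const_sub I
    simpa using this
  refine le_of_tendsto (continuous_coe_real_ereal.continuousAt.tendsto.comp hlim) ?_
  filter_upwards [eventually_gt_atTop 0] with n h using hn n h

/-- Below any value less than g(x) there is room for a scaled bump at x, so g is the supremum of its
continuous compactly supported minorants. Second countability reduces these to a countable family,
and partial suprema make it increasing. -/
theorem exists_continuous_seq_iSup_eq {E : Type*} [NormedAddCommGroup E] [NormedSpace ℝ E]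
    [FiniteDimensional ℝ E] {g : E → ℝ≥0∞} (hg : LowerSemicontinuous g) :
    ∃ F : ℕ → E → ℝ, Monotone F ∧ (∀ n, Continuous (F n)) ∧ (∀ n, HasCompactSupport (F n)) ∧
      (∀ n x, 0 ≤ F n x) ∧ ∀ x, ⨆ n, ENNReal.ofReal (F n x) = g x := by
  have : ProperSpace E := FiniteDimensional.proper ℝ E
  let P : (E → ℝ) → Prop := fun F => Continuous F ∧ HasCompactSupport F ∧ (∀ x, 0 ≤ F x) ∧
    ∀ x, ENNReal.ofReal (F x) ≤ g x
  let 𝓕 : Set (E → ℝ≥0∞) := (fun F x => ENNReal.ofReal (F x)) '' {F | P F}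
  have hcont : ∀ h ∈ 𝓕, LowerSemicontinuous h := by
    rintro _ ⟨F, hF, rfl⟩
    exact (ENNReal.continuous_ofReal.comp hF.1).lowerSemicontinuous
  have hlub : IsLUB 𝓕 g := by
    refine ⟨?_, fun u hu x => ?_⟩
    · rintro _ ⟨F, hF, rfl⟩ x
      exact hF.2.2.2 x
    · refine le_of_forall_lt fun c hc => ?_
      obtain ⟨r, hcr, hr⟩ := ENNReal.lt_iff_exists_nnreal_btwn.1 hc
      obtain ⟨ε, hε, hball⟩ := Metric.isOpen_iff.1 (hg.isOpen_preimage (r : ℝ≥0∞)) x hr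
      let β : ContDiffBump x := ⟨ε / 2, ε, by positivity, by linarith⟩
      have hP : P (fun y => r * β y) := by
        refine ⟨continuous_const.mul β.continuous, β.hasCompactSupport.mul_left,
          fun y => mul_nonneg r.2 β.nonneg, fun y => ?_⟩
        by_cases hy : y ∈ Metric.ball x ε
        · refine le_trans ?_ (le_of_lt (hball hy))
          rw [← ENNReal.ofReal_coe_nnreal]
          exact ENNReal.ofReal_le_ofReal (mul_le_of_le_one_right r.2 β.le_one)
        · beta_reduce
          rw [β.zero_of_le_dist (not_lt.1 hy)]
          simp
      have := hu ⟨_, hP, rfl⟩ x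
      beta_reduce at this
      rw [β.one_of_mem_closedBall (Metric.mem_closedBall_self (by positivity))] at this
      refine hcr.trans_le ?_
      simpa using this
  obtain ⟨𝓕', hsub, hcount, hlub'⟩ := exists_countable_lowerSemicontinuous_isLUB hcont hlub
  have hP0 : P 0 := ⟨continuous_const, HasCompactSupport.zero, fun _ => le_rfl, fun _ => by simp⟩
  have hch : ∀ h : 𝓕', ∃ F, P F ∧ (fun x => ENNReal.ofReal (F x)) = h := fun h => hsub h.2
  choose G hGP hG using hch
  have : Countable 𝓕' := hcount
  -- Adjoining one element, sent to the zero function, gives an enumeration even when the countable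
  -- family is empty.
  obtain ⟨e, he⟩ : ∃ e : ℕ → Option 𝓕', Function.Surjective e :=
    exists_surjective_nat (Option 𝓕')
  let G' : Option 𝓕' → E → ℝ := fun o => o.elim 0 G
  have hG'P : ∀ o, P (G' o) := by
    rintro (_ | h)
    · exact hP0
    · exact hGP h
  have hsup : ∀ F₁ F₂, P F₁ → P F₂ → P (F₁ ⊔ F₂) := by
    intro F₁ F₂ h₁ h₂
    refine ⟨h₁.1.max h₂.1, ?_, fun x => le_sup_of_le_left (h₁.2.2.1 x), fun x => ?_⟩
    · refine HasCompactSupport.intro (h₁.2.1.isCompact.union h₂.2.1.isCompact) fun x hx => ?_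
      rw [Set.mem_union, not_or] at hx
      simp [image_eq_zero_of_notMem_tsupport hx.1, image_eq_zero_of_notMem_tsupport hx.2]
    · rw [Pi.sup_apply, ENNReal.ofReal_max]
      exact max_le (h₁.2.2.2 x) (h₂.2.2.2 x)
  have hPs : ∀ n, P (partialSups (fun n => G' (e n)) n) := by
    intro n
    induction n with
    | zero => simpa using hG'P _
    | succ n ih => rw [partialSups_add_one]; exact hsup _ _ ih (hG'P _)
  refine ⟨partialSups (fun n => G' (e n)), (partialSups _).monotone, fun n => (hPs n).1,
    fun n => (hPs n).2.1, fun n => (hPs n).2.2.1, fun x => le_antisymm ?_ ?_⟩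
  · exact iSup_le fun n => (hPs n).2.2.2 x
  · have h1 : g ≤ fun x => ⨆ n, ENNReal.ofReal (partialSups (fun n => G' (e n)) n x) := by
      refine hlub'.2 fun h hh x => ?_
      obtain ⟨n, hn⟩ := he (some ⟨h, hh⟩)
      refine le_trans ?_ (le_iSup _ n)
      have h2 : h x = ENNReal.ofReal (G ⟨h, hh⟩ x) := (congrFun (hG ⟨h, hh⟩) x).symm
      rw [h2]
      refine ENNReal.ofReal_le_ofReal ?_
      have h3 := le_partialSups (fun n => G' (e n)) n x
      beta_reduce at h3
      rw [hn] at h3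
      exact h3
    exact h1 x

/-- Averages of a nonnegative superharmonic function over centred isotropic normal distributions
do not exceed the function. -/
theorem gaussAvg_le_of_isSuperharmonicOn {g : EuclideanSpace ℝ (Fin d) → ℝ≥0∞}
    (hg : IsSuperharmonicOn (fun x => (g x : EReal)) Set.univ) (hlsc : LowerSemicontinuous g)
    {T : ℝ} (hT : 0 < T) (x : EuclideanSpace ℝ (Fin d)) : gaussAvg (T • 1) g x ≤ g x := by
  rcases eq_or_ne d 0 with rfl | hd
  -- In dimension 0 the sphere argument is unavailable, but every function is constant.
  · have : g = fun _ => g x := funext fun y => by rw [Subsingleton.elim y x]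
    rw [this, gaussAvg_const]
  obtain ⟨F, hmono, hcont, hcs, hnn, hsup⟩ := exists_continuous_seq_iSup_eq hlsc
  have h1 : gaussAvg (T • 1) g x = ⨆ n, ∫⁻ z, ENNReal.ofReal (F n (x + z))
      ∂(multivariateGaussian 0 (T • 1)) := by
    rw [gaussAvg, ← lintegral_iSup]
    · simp_rw [hsup]
    · intro n
      have := hcont n
      fun_prop
    · intro m n hmn z
      exact ENNReal.ofReal_le_ofReal (hmono hmn _)
  rw [h1]
  refine iSup_le fun n => ?_
  have hint := integrable_comp_const_add (hcont n) (hcs n) (multivariateGaussian 0 (T • 1)) x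
  rw [← ofReal_integral_eq_lintegral_ofReal hint (ae_of_all _ fun z => hnn n _)]
  refine ENNReal.le_of_forall_pos_le_add fun ε hε _ => ?_
  have hε' : (0 : ℝ) < ε / 2 := by positivity
  -- The smooth φ costs ε/2 twice: φ - ε/2 must lie below g, and the average of φ must be compared
  -- with that of `F n`.
  obtain ⟨φ, hφ, hdist, hsupp⟩ := (hcont n).exists_contDiff_approx 3
    (ε := fun _ => (ε / 2 : ℝ)) continuous_const fun _ => hε'
  have hφc : HasCompactSupport φ := (hcs n).mono hsupp
  have hclose : ∀ y, |φ y - F n y| < ε / 2 := fun y => by simpa [Real.dist_eq] using hdist y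
  have key := hg.integral_smooth_sub_le hd (hφ) hφc (b := ε / 2) hT (fun y => by
    have h2 : φ y - ε / 2 ≤ F n y := by have := abs_lt.1 (hclose y); linarith
    have h3 : ENNReal.ofReal (F n y) ≤ g y := by rw [← hsup y]; exact le_iSup (fun n => ENNReal.ofReal (F n y)) n
    calc ((φ y - ε / 2 : ℝ) : EReal) ≤ (F n y : EReal) := by exact_mod_cast h2
      _ = ((ENNReal.ofReal (F n y) : ℝ≥0∞) : EReal) := by
        rw [EReal.coe_ennreal_ofReal, max_eq_left (hnn n y)]
      _ ≤ g y := by exact_mod_cast h3) x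
  have h4 : ∫ z, F n (x + z) ∂(multivariateGaussian 0 (T • 1)) - ε / 2 ≤
      ∫ z, φ (x + z) ∂(multivariateGaussian 0 (T • 1)) := by
    have e : ∫ z, (F n (x + z) - ε / 2) ∂(multivariateGaussian 0 (T • 1)) =
        ∫ z, F n (x + z) ∂(multivariateGaussian 0 (T • 1)) - ε / 2 := by
      rw [integral_sub hint (integrable_const _)]
      simp
    rw [← e]
    refine integral_mono (hint.sub (integrable_const _))
      (integrable_comp_const_add hφ.continuous hφc _ x) fun z => ?_
    have := abs_lt.1 (hclose (x + z))
    simp only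
    linarith
  have h5 : ((∫ z, F n (x + z) ∂(multivariateGaussian 0 (T • 1)) - ε : ℝ) : EReal) ≤ g x := by
    refine le_trans ?_ key
    rw [EReal.coe_le_coe_iff]
    linarith
  by_cases htop : g x = ∞
  · simp [htop]
  lift g x to NNReal using htop with r
  have h6 : ∫ z, F n (x + z) ∂(multivariateGaussian 0 (T • 1)) - ε ≤ r := by
    rw [← EReal.coe_le_coe_iff]
    exact h5
  rw [← ENNReal.coe_add, ENNReal.ofReal_le_iff_le_toReal ENNReal.coe_ne_top]
  simp only [ENNReal.coe_toReal, NNReal.coe_add]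
  linarith

end SuperharmonicGaussian

/-! ### Matrix identities for the pooled covariance and for A* -/

section MatrixFacts

variable {d : ℕ} {S S' U : Matrix (Fin d) (Fin d) ℝ} {lam : Fin d → ℝ}

theorem posDef_transpose_eq (hS : S.PosDef) : Sᵀ = S := by
  simpa [conjTranspose_eq_transpose_of_trivial] using hS.isHermitian.eq

theorem posDef_det_isUnit (hS : S.PosDef) : IsUnit S.det := isUnit_iff_ne_zero.2 hS.det_pos.ne'

theorem posDef_sigmaW (hS : S.PosDef) (hS' : S'.PosDef) : (sigmaW S S').PosDef :=
  (hS.inv.add hS'.inv).inv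

theorem sigmaW_eq (hS : S.PosDef) (hS' : S'.PosDef) : sigmaW S S' = S * (S + S')⁻¹ * S' := by
  have u := posDef_det_isUnit hS
  have u' := posDef_det_isUnit hS'
  have v := posDef_det_isUnit (hS.add hS')
  refine Matrix.inv_eq_right_inv ?_
  have h : S⁻¹ + S'⁻¹ = S'⁻¹ * (S + S') * S⁻¹ := by
    rw [Matrix.mul_add, Matrix.add_mul, nonsing_inv_mul _ u', Matrix.mul_assoc,
      mul_nonsing_inv _ u, Matrix.one_mul, Matrix.mul_one, add_comm]
  rw [h]
  calc S'⁻¹ * (S + S') * S⁻¹ * (S * (S + S')⁻¹ * S')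
      = S'⁻¹ * ((S + S') * (S⁻¹ * S) * (S + S')⁻¹) * S' := by simp only [Matrix.mul_assoc]
    _ = 1 := by
      rw [nonsing_inv_mul _ u, Matrix.mul_one, mul_nonsing_inv _ v, Matrix.mul_one,
        nonsing_inv_mul _ u']

theorem sub_sigmaW_eq (hS : S.PosDef) (hS' : S'.PosDef) :
    S - sigmaW S S' = S * (S + S')⁻¹ * S := by
  have v := posDef_det_isUnit (hS.add hS')
  have : S = S * (S + S')⁻¹ * (S + S') := by
    rw [Matrix.mul_assoc, nonsing_inv_mul _ v, Matrix.mul_one]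
  rw [sigmaW_eq hS hS']
  nth_rewrite 1 [this]
  rw [Matrix.mul_add, add_sub_cancel_right]

theorem PosDef.mul_mul_transpose {M A : Matrix (Fin d) (Fin d) ℝ} (hM : M.PosDef)
    (hA : IsUnit A.det) : (A * M * Aᵀ).PosDef := by
  have h := hM.mul_mul_conjTranspose_same (B := A)
    (Matrix.vecMul_injective_iff_isUnit.2 ((Matrix.isUnit_iff_isUnit_det A).2 hA))
  simpa [conjTranspose_eq_transpose_of_trivial] using h

theorem posDef_sub_sigmaW (hS : S.PosDef) (hS' : S'.PosDef) : (S - sigmaW S S').PosDef := by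
  rw [sub_sigmaW_eq hS hS']
  nth_rewrite 3 [← posDef_transpose_eq hS]
  exact PosDef.mul_mul_transpose (hS.add hS').inv (posDef_det_isUnit hS)

theorem psdSqrt_mul_self (hS : S.PosDef) : psdSqrt S * psdSqrt S = S := by
  open scoped MatrixOrder in
  exact CFC.sqrt_mul_sqrt_self _ hS.posSemidef.nonneg

theorem psdSqrt_transpose (S : Matrix (Fin d) (Fin d) ℝ) : (psdSqrt S)ᵀ = psdSqrt S := by
  open scoped MatrixOrder in
  have : (CFC.sqrt S).IsHermitian := (CFC.sqrt_nonneg S).posSemidef.isHermitian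
  simpa [psdSqrt, conjTranspose_eq_transpose_of_trivial] using this.eq

theorem psdSqrt_det_isUnit (hS : S.PosDef) : IsUnit (psdSqrt S).det := by
  have : IsUnit ((psdSqrt S).det * (psdSqrt S).det) := by
    rw [← det_mul, psdSqrt_mul_self hS]
    exact posDef_det_isUnit hS
  exact isUnit_of_mul_isUnit_left this

/-- With R = W^{1/2}, inverting the diagonalization gives Λ⁻¹ = U R⁻¹ S R⁻¹ Uᵀ, hence Λ⁻¹ - I = U
R⁻¹ (S - W) R⁻¹ Uᵀ. Conjugating back by R Uᵀ recovers S - W. Any choice of U therefore gives the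
same product. -/
theorem aStar_mul_transpose (hS : S.PosDef) (hS' : S'.PosDef)
    (hU : IsDiagonalization (sigmaW S S') S U lam) :
    aStar (sigmaW S S') U lam * (aStar (sigmaW S S') U lam)ᵀ = S - sigmaW S S' := by
  have hW := posDef_sigmaW hS hS'
  obtain ⟨hO, hD⟩ := hU
  set R := psdSqrt (sigmaW S S') with hR
  have uR : IsUnit R.det := psdSqrt_det_isUnit hW
  have uS := posDef_det_isUnit hS
  have hRR : R * R = sigmaW S S' := psdSqrt_mul_self hW
  have hRT : Rᵀ = R := psdSqrt_transpose _
  have hUU : U * Uᵀ = 1 := by simpa [star_eq_conjTranspose] using (mem_orthogonalGroup_iff _ _).1 hO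
  have hUU' : Uᵀ * U = 1 := by
    simpa [star_eq_conjTranspose] using (mem_orthogonalGroup_iff' _ _).1 hO
  have hdiag : diagonal lam = U * (R * S⁻¹ * R) * Uᵀ := by
    rw [hD]
    calc diagonal lam = (U * Uᵀ) * diagonal lam * (U * Uᵀ) := by rw [hUU]; simp
      _ = _ := by simp only [Matrix.mul_assoc]
  have hlam : ∀ i, lam i ≠ 0 := by
    have : IsUnit (diagonal lam).det := by
      rw [hdiag, det_mul, det_mul, det_mul, det_mul]
      have uU : IsUnit (U.det * Uᵀ.det) := by rw [← det_mul, hUU]; simp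
      exact ((((isUnit_of_mul_isUnit_left uU)).mul ((uR.mul
        (posDef_det_isUnit hS.inv)).mul uR)).mul (isUnit_of_mul_isUnit_right uU))
    rw [det_diagonal, isUnit_iff_ne_zero, Finset.prod_ne_zero_iff] at this
    exact fun i => this i (Finset.mem_univ i)
  have hinv : diagonal (fun i => (lam i)⁻¹) = U * (R⁻¹ * S * R⁻¹) * Uᵀ := by
    have h1 : diagonal lam * diagonal (fun i => (lam i)⁻¹) = 1 := by
      rw [diagonal_mul_diagonal, ← diagonal_one]
      congr 1
      ext i
      exact mul_inv_cancel₀ (hlam i)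
    rw [← Matrix.inv_eq_right_inv h1]
    refine Matrix.inv_eq_right_inv ?_
    rw [hdiag]
    calc U * (R * S⁻¹ * R) * Uᵀ * (U * (R⁻¹ * S * R⁻¹) * Uᵀ)
        = U * (R * S⁻¹ * R) * (Uᵀ * U) * ((R⁻¹ * S * R⁻¹) * Uᵀ) := by
          simp only [Matrix.mul_assoc]
      _ = U * R * (S⁻¹ * (R * R⁻¹) * S) * R⁻¹ * Uᵀ := by
          rw [hUU', Matrix.mul_one]
          simp only [Matrix.mul_assoc]
      _ = 1 := by
          rw [mul_nonsing_inv _ uR, Matrix.mul_one, nonsing_inv_mul _ uS, Matrix.mul_one,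
            Matrix.mul_assoc U, mul_nonsing_inv _ uR, Matrix.mul_one, hUU]
  have hB : diagonal (fun i => (lam i)⁻¹ - 1) =
      (U * R⁻¹) * (S - sigmaW S S') * (U * R⁻¹)ᵀ := by
    have h2 : diagonal (fun i => (lam i)⁻¹ - 1) = diagonal (fun i => (lam i)⁻¹) - 1 := by
      rw [← diagonal_one, diagonal_sub]
    have h3 : R⁻¹ * (S - R * R) * R⁻¹ = R⁻¹ * S * R⁻¹ - 1 := by
      rw [Matrix.mul_sub, Matrix.sub_mul, ← Matrix.mul_assoc R⁻¹ R R, nonsing_inv_mul _ uR,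
        Matrix.one_mul, mul_nonsing_inv _ uR]
    rw [h2, hinv, transpose_mul, transpose_nonsing_inv, hRT, ← hRR]
    calc U * (R⁻¹ * S * R⁻¹) * Uᵀ - 1 = U * (R⁻¹ * S * R⁻¹ - 1) * Uᵀ := by
          rw [Matrix.mul_sub, Matrix.sub_mul, Matrix.mul_one, hUU]
      _ = _ := by
          rw [← h3]
          simp only [Matrix.mul_assoc]
  -- Positivity is inherited by congruence from S - W; it ensures that the real square roots in A*
  -- are not truncated at 0.
  have hpos : ∀ i, 0 < (lam i)⁻¹ - 1 := by
    have : (diagonal (fun i => (lam i)⁻¹ - 1)).PosDef := by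
      rw [hB]
      refine PosDef.mul_mul_transpose (posDef_sub_sigmaW hS hS') ?_
      rw [det_mul]
      have uU : IsUnit (U.det * Uᵀ.det) := by rw [← det_mul, hUU]; simp
      exact (isUnit_of_mul_isUnit_left uU).mul (isUnit_nonsing_inv_det _ uR)
    exact posDef_diagonal_iff.1 this
  have hsq : diagonal (fun i => √((lam i)⁻¹ - 1)) * (diagonal (fun i => √((lam i)⁻¹ - 1)))ᵀ =
      diagonal (fun i => (lam i)⁻¹ - 1) := by
    rw [diagonal_transpose, diagonal_mul_diagonal]
    congr 1
    ext i
    exact Real.mul_self_sqrt (hpos i).le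
  rw [aStar, ← hR, transpose_mul, transpose_mul, transpose_transpose, hRT]
  calc R * Uᵀ * diagonal (fun i => √((lam i)⁻¹ - 1)) *
        ((diagonal (fun i => √((lam i)⁻¹ - 1)))ᵀ * (U * R))
      = R * Uᵀ * (diagonal (fun i => √((lam i)⁻¹ - 1)) *
        (diagonal (fun i => √((lam i)⁻¹ - 1)))ᵀ) * (U * R) := by simp only [Matrix.mul_assoc]
    _ = R * (Uᵀ * U) * R⁻¹ * (S - sigmaW S S') * R⁻¹ * (Uᵀ * U) * R := by
      rw [hsq, hB, transpose_mul, transpose_nonsing_inv, hRT]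
      simp only [Matrix.mul_assoc]
    _ = S - sigmaW S S' := by
      rw [hUU', Matrix.mul_one, Matrix.mul_one, mul_nonsing_inv _ uR, Matrix.one_mul,
        Matrix.mul_assoc, nonsing_inv_mul _ uR, Matrix.mul_one]

/-- The left side is the covariance of the precision-weighted mean of independent observations with
covariances S and S'. -/
theorem sigmaW_covariance (hS : S.PosDef) (hS' : S'.PosDef) :
    (sigmaW S S' * S⁻¹) * S * (sigmaW S S' * S⁻¹)ᵀ +
      (sigmaW S S' * S'⁻¹) * S' * (sigmaW S S' * S'⁻¹)ᵀ = sigmaW S S' := by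
  have u := posDef_det_isUnit hS
  have u' := posDef_det_isUnit hS'
  have uw := posDef_det_isUnit (hS.inv.add hS'.inv)
  have hWT := posDef_transpose_eq (posDef_sigmaW hS hS')
  rw [transpose_mul, transpose_mul, hWT, posDef_transpose_eq hS.inv, posDef_transpose_eq hS'.inv]
  calc sigmaW S S' * S⁻¹ * S * (S⁻¹ * sigmaW S S') +
        sigmaW S S' * S'⁻¹ * S' * (S'⁻¹ * sigmaW S S')
      = sigmaW S S' * (S⁻¹ * S) * S⁻¹ * sigmaW S S' +
        sigmaW S S' * (S'⁻¹ * S') * S'⁻¹ * sigmaW S S' := by simp only [Matrix.mul_assoc]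
    _ = sigmaW S S' * ((S⁻¹ + S'⁻¹) * sigmaW S S') := by
      rw [nonsing_inv_mul _ u, nonsing_inv_mul _ u']
      simp only [Matrix.mul_one, Matrix.add_mul, Matrix.mul_add, Matrix.mul_assoc]
    _ = sigmaW S S' := by
      rw [sigmaW, mul_nonsing_inv _ uw, Matrix.mul_one]

theorem sigmaW_mean (hS : S.PosDef) (hS' : S'.PosDef) :
    sigmaW S S' * S⁻¹ + sigmaW S S' * S'⁻¹ = 1 := by
  rw [← Matrix.mul_add, sigmaW, nonsing_inv_mul _ (posDef_det_isUnit (hS.inv.add hS'.inv))]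

theorem det_add_mul_det_sigmaW (hS : S.PosDef) (hS' : S'.PosDef) :
    (S + S').det * (sigmaW S S').det = S.det * S'.det := by
  have v := posDef_det_isUnit (hS.add hS')
  rw [sigmaW_eq hS hS', det_mul, det_mul]
  have : (S + S').det * (S + S')⁻¹.det = 1 := by rw [← det_mul, mul_nonsing_inv _ v, det_one]
  linear_combination (S.det * S'.det) * this

theorem inv_mul_sigmaW_mul_inv (hS : S.PosDef) (hS' : S'.PosDef) :
    S⁻¹ * sigmaW S S' * S'⁻¹ = (S + S')⁻¹ := by
  rw [sigmaW_eq hS hS']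
  calc S⁻¹ * (S * (S + S')⁻¹ * S') * S'⁻¹ = (S⁻¹ * S) * (S + S')⁻¹ * (S' * S'⁻¹) := by
        simp only [Matrix.mul_assoc]
    _ = _ := by
      rw [nonsing_inv_mul _ (posDef_det_isUnit hS), mul_nonsing_inv _ (posDef_det_isUnit hS'),
        Matrix.one_mul, Matrix.mul_one]

/-- Completing the square in the product of two normal densities. -/
theorem quadratic_add_quadratic (hS : S.PosDef) (hS' : S'.PosDef) (a b : Fin d → ℝ) :
    a ⬝ᵥ S⁻¹ *ᵥ a + b ⬝ᵥ S'⁻¹ *ᵥ b = (b - a) ⬝ᵥ (S + S')⁻¹ *ᵥ (b - a) +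
      (sigmaW S S' *ᵥ (S⁻¹ *ᵥ a + S'⁻¹ *ᵥ b)) ⬝ᵥ
        (sigmaW S S')⁻¹ *ᵥ (sigmaW S S' *ᵥ (S⁻¹ *ᵥ a + S'⁻¹ *ᵥ b)) := by
  have hW := posDef_sigmaW hS hS'
  set W := sigmaW S S' with hWdef
  set P := S⁻¹ with hP
  set Q := S'⁻¹ with hQ
  have hWT : Wᵀ = W := posDef_transpose_eq hW
  have hPT : Pᵀ = P := posDef_transpose_eq hS.inv
  have hQT : Qᵀ = Q := posDef_transpose_eq hS'.inv
  have hPWQ : (S + S')⁻¹ = P * W * Q := (inv_mul_sigmaW_mul_inv hS hS').symm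
  have hQWP : (S + S')⁻¹ = Q * W * P := by
    rw [← posDef_transpose_eq (hS.add hS').inv, hPWQ]
    simp [transpose_mul, hWT, hPT, hQT, Matrix.mul_assoc]
  have hsum : W * P + W * Q = 1 := sigmaW_mean hS hS'
  have eP : P * W * P = P - (S + S')⁻¹ := by
    rw [hPWQ, eq_sub_iff_add_eq, Matrix.mul_assoc, Matrix.mul_assoc, ← Matrix.mul_add, hsum,
      Matrix.mul_one]
  have eQ : Q * W * Q = Q - (S + S')⁻¹ := by
    rw [hQWP, eq_sub_iff_add_eq, Matrix.mul_assoc, Matrix.mul_assoc, ← Matrix.mul_add,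
      add_comm (W * Q), hsum, Matrix.mul_one]
  have hWc : W⁻¹ *ᵥ (W *ᵥ (P *ᵥ a + Q *ᵥ b)) = P *ᵥ a + Q *ᵥ b := by
    rw [mulVec_mulVec, nonsing_inv_mul _ (posDef_det_isUnit hW), one_mulVec]
  rw [hWc]
  have move : ∀ (X Y : Matrix (Fin d) (Fin d) ℝ) (u v : Fin d → ℝ), Yᵀ = Y →
      (W *ᵥ (X *ᵥ u)) ⬝ᵥ (Y *ᵥ v) = v ⬝ᵥ (Y * W * X) *ᵥ u := by
    intro X Y u v hY
    rw [← mulVec_mulVec, ← mulVec_mulVec, dotProduct_mulVec v, ← mulVec_transpose, hY,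
      dotProduct_comm]
  rw [mulVec_add, add_dotProduct, dotProduct_add, dotProduct_add, move _ _ _ _ hPT,
    move _ _ _ _ hQT, move _ _ _ _ hPT, move _ _ _ _ hQT, eP, eQ, ← hPWQ, ← hQWP]
  simp only [sub_mulVec, mulVec_sub, dotProduct_sub, sub_dotProduct]
  ring

end MatrixFacts

/-! ### Bounds for normal densities and factorization of their product -/

section DensityBounds

variable {d : ℕ} {S S' : Matrix (Fin d) (Fin d) ℝ}

theorem exists_quadratic_le (S : Matrix (Fin d) (Fin d) ℝ) :
    ∃ β : ℝ, 0 < β ∧ ∀ v : EuclideanSpace ℝ (Fin d), v.ofLp ⬝ᵥ S *ᵥ v.ofLp ≤ β * ‖v‖ ^ 2 := by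
  refine ⟨‖toEuclideanCLM (𝕜 := ℝ) S‖ + 1, by positivity, fun v => ?_⟩
  rw [← inner_toEuclideanCLM]
  calc inner ℝ v (toEuclideanCLM (𝕜 := ℝ) S v) ≤ ‖v‖ * ‖toEuclideanCLM (𝕜 := ℝ) S v‖ :=
        real_inner_le_norm _ _
    _ ≤ ‖v‖ * (‖toEuclideanCLM (𝕜 := ℝ) S‖ * ‖v‖) := by
        gcongr
        exact ContinuousLinearMap.le_opNorm _ _
    _ ≤ _ := by nlinarith [sq_nonneg ‖v‖]

theorem exists_le_quadratic (hS : S.PosDef) :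
    ∃ α : ℝ, 0 < α ∧ ∀ v : EuclideanSpace ℝ (Fin d), α * ‖v‖ ^ 2 ≤ v.ofLp ⬝ᵥ S *ᵥ v.ofLp := by
  set R := psdSqrt S
  set K := ‖toEuclideanCLM (𝕜 := ℝ) R⁻¹‖
  refine ⟨1 / (K ^ 2 + 1), by positivity, fun v => ?_⟩
  have h1 : ‖v‖ ≤ K * ‖toEuclideanCLM (𝕜 := ℝ) R v‖ := by
    have : toEuclideanCLM (𝕜 := ℝ) R⁻¹ (toEuclideanCLM (𝕜 := ℝ) R v) = v := by
      change (toEuclideanCLM (𝕜 := ℝ) R⁻¹ * toEuclideanCLM (𝕜 := ℝ) R) v = v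
      rw [← map_mul, nonsing_inv_mul _ (psdSqrt_det_isUnit hS)]
      simp
    conv_lhs => rw [← this]
    exact ContinuousLinearMap.le_opNorm _ _
  have h2 : v.ofLp ⬝ᵥ S *ᵥ v.ofLp = ‖toEuclideanCLM (𝕜 := ℝ) R v‖ ^ 2 := by
    rw [← real_inner_self_eq_norm_sq, inner_toEuclideanCLM, ← psdSqrt_mul_self hS,
      ← mulVec_mulVec, dotProduct_mulVec, ← mulVec_transpose, psdSqrt_transpose]
    rfl
  rw [h2, div_mul_eq_mul_div, one_mul, div_le_iff₀ (by positivity)]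
  have h3 : ‖v‖ ^ 2 ≤ K ^ 2 * ‖toEuclideanCLM (𝕜 := ℝ) R v‖ ^ 2 := by
    rw [← mul_pow]
    exact pow_le_pow_left₀ (norm_nonneg _) h1 2
  nlinarith [sq_nonneg ‖toEuclideanCLM (𝕜 := ℝ) R v‖]

/-- The normalizing constant of the normal density with covariance matrix `S`. -/
noncomputable def normalConst (S : Matrix (Fin d) (Fin d) ℝ) : ℝ :=
  1 / ((2 * Real.pi) ^ ((d : ℝ) / 2) * √S.det)

theorem normalConst_pos (hS : S.PosDef) : 0 < normalConst S := by
  have := hS.det_pos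
  rw [normalConst]
  positivity

theorem log_normalDensity (hS : S.PosDef) (x y : EuclideanSpace ℝ (Fin d)) :
    Real.log (normalDensity x S y).toReal =
      Real.log (normalConst S) - (y - x).ofLp ⬝ᵥ (S⁻¹ *ᵥ (y - x).ofLp) / 2 := by
  have := normalConst_pos hS
  rw [normalDensity, ENNReal.toReal_ofReal (by have := hS.det_pos; positivity)]
  change Real.log (normalConst S * _) = _
  rw [Real.log_mul this.ne' (Real.exp_pos _).ne', Real.log_exp]
  ring

theorem exists_abs_log_normalDensity_le (hS : S.PosDef) :
    ∃ C : ℝ, 0 ≤ C ∧ ∀ x y : EuclideanSpace ℝ (Fin d),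
      |Real.log (normalDensity x S y).toReal| ≤ C * (1 + ‖x‖ ^ 2 + ‖y‖ ^ 2) := by
  obtain ⟨β, hβ, hle⟩ := exists_quadratic_le S⁻¹
  refine ⟨|Real.log (normalConst S)| + β, by positivity, fun x y => ?_⟩
  rw [log_normalDensity hS]
  have h0 : 0 ≤ (y - x).ofLp ⬝ᵥ (S⁻¹ *ᵥ (y - x).ofLp) := by
    simpa using hS.inv.posSemidef.dotProduct_mulVec_nonneg (y - x).ofLp
  have h1 := hle (y - x)
  have h2 : ‖y - x‖ ^ 2 ≤ 2 * (‖x‖ ^ 2 + ‖y‖ ^ 2) := by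
    have := norm_sub_le y x
    nlinarith [sq_nonneg (‖x‖ - ‖y‖), norm_nonneg (y - x), norm_nonneg x, norm_nonneg y]
  refine (abs_sub _ _).trans ?_
  rw [abs_of_nonneg (show 0 ≤ (y - x).ofLp ⬝ᵥ (S⁻¹ *ᵥ (y - x).ofLp) / 2 by positivity)]
  nlinarith [abs_nonneg (Real.log (normalConst S)), sq_nonneg ‖x‖, sq_nonneg ‖y‖,
    mul_nonneg (abs_nonneg (Real.log (normalConst S))) (add_nonneg (sq_nonneg ‖x‖) (sq_nonneg ‖y‖))]

theorem exists_normalDensity_le (hS : S.PosDef) :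
    ∃ k α : ℝ, 0 < k ∧ 0 < α ∧ ∀ x y : EuclideanSpace ℝ (Fin d),
      normalDensity x S y ≤ ENNReal.ofReal (k * Real.exp (-(α * ‖y - x‖ ^ 2))) := by
  obtain ⟨α, hα, hle⟩ := exists_le_quadratic hS.inv
  refine ⟨normalConst S, α / 2, normalConst_pos hS, by positivity, fun x y => ?_⟩
  refine ENNReal.ofReal_le_ofReal (mul_le_mul_of_nonneg_left ?_ (normalConst_pos hS).le)
  rw [Real.exp_le_exp]
  linarith [hle (y - x)]

/-- The rate β / t has β chosen before t, so a large t makes the decay as slow as desired; only the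
prefactor k depends on t. -/
theorem exists_le_normalDensity_smul (hS : S.PosDef) :
    ∃ β : ℝ, 0 < β ∧ ∀ t : ℝ, 0 < t → ∃ k : ℝ, 0 < k ∧ ∀ x y : EuclideanSpace ℝ (Fin d),
      ENNReal.ofReal (k * Real.exp (-(β / t * ‖y - x‖ ^ 2))) ≤ normalDensity x (t • S) y := by
  obtain ⟨β, hβ, hle⟩ := exists_quadratic_le S⁻¹
  refine ⟨β / 2, by positivity, fun t ht => ?_⟩
  refine ⟨normalConst (t • S), normalConst_pos (hS.smul ht), fun x y => ?_⟩
  refine ENNReal.ofReal_le_ofReal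
    (mul_le_mul_of_nonneg_left ?_ (normalConst_pos (hS.smul ht)).le)
  rw [Real.exp_le_exp]
  have h : (t • S)⁻¹ = t⁻¹ • S⁻¹ := by
    have : Invertible t := invertibleOfNonzero ht.ne'
    rw [Matrix.inv_smul _ _ (posDef_det_isUnit hS), invOf_eq_inv]
  rw [h, smul_mulVec, dotProduct_smul, smul_eq_mul]
  have h2 := mul_le_mul_of_nonneg_left (hle (y - x)) (inv_pos.2 ht).le
  calc -(β / 2 / t * ‖y - x‖ ^ 2) = -(t⁻¹ * (β * ‖y - x‖ ^ 2)) / 2 := by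
        field_simp
    _ ≤ _ := by linarith

/-- As a function of ν the product is a normal density around the pooled mean, times the marginal
density of y' - y. The exponents match by completing the square, the constants by the determinant
identity. -/
theorem normalDensity_mul_normalDensity (hS : S.PosDef) (hS' : S'.PosDef)
    (y y' ν : EuclideanSpace ℝ (Fin d)) :
    normalDensity ν S' y' * normalDensity ν S y = normalDensity y (S + S') y' *
      normalDensity (toEuclideanLin (sigmaW S S' * S⁻¹) y + toEuclideanLin (sigmaW S S' * S'⁻¹) y')
        (sigmaW S S') ν := by
  have hW := posDef_sigmaW hS hS'
  have hc : normalConst S' * normalConst S = normalConst (S + S') * normalConst (sigmaW S S') := by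
    have h : √(S + S').det * √(sigmaW S S').det = √S.det * √S'.det := by
      rw [← Real.sqrt_mul (hS.add hS').det_pos.le, ← Real.sqrt_mul hS.det_pos.le,
        det_add_mul_det_sigmaW hS hS']
    have h1 : 0 < √(S + S').det := Real.sqrt_pos.2 (hS.add hS').det_pos
    have h2 : 0 < √(sigmaW S S').det := Real.sqrt_pos.2 hW.det_pos
    have h3 : 0 < √S.det := Real.sqrt_pos.2 hS.det_pos
    have h4 : 0 < √S'.det := Real.sqrt_pos.2 hS'.det_pos
    simp only [normalConst, ← one_div_mul_one_div]
    rw [mul_mul_mul_comm, mul_mul_mul_comm (1 / (2 * Real.pi) ^ ((d : ℝ) / 2))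
      (1 / √(S + S').det), one_div_mul_one_div (√(S + S').det), h, one_div_mul_one_div (√S'.det),
      mul_comm (√S'.det)]
  have hq := quadratic_add_quadratic hS hS' (y - ν).ofLp (y' - ν).ofLp
  have e1 : (y' - ν).ofLp - (y - ν).ofLp = (y' - y).ofLp := by simp
  have e2 : sigmaW S S' *ᵥ (S⁻¹ *ᵥ (y - ν).ofLp + S'⁻¹ *ᵥ (y' - ν).ofLp) =
      (toEuclideanLin (sigmaW S S' * S⁻¹) y + toEuclideanLin (sigmaW S S' * S'⁻¹) y' - ν).ofLp := by
    have hν : ν.ofLp = (sigmaW S S' * S⁻¹) *ᵥ ν.ofLp + (sigmaW S S' * S'⁻¹) *ᵥ ν.ofLp := by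
      rw [← add_mulVec, sigmaW_mean hS hS', one_mulVec]
    simp only [WithLp.ofLp_sub, WithLp.ofLp_add, toLpLin_apply]
    nth_rewrite 3 [hν]
    simp only [mulVec_add, mulVec_sub, mulVec_mulVec]
    abel
  rw [e1, e2] at hq
  rw [normalDensity_symm (sigmaW S S')]
  set z := toEuclideanLin (sigmaW S S' * S⁻¹) y + toEuclideanLin (sigmaW S S' * S'⁻¹) y'
  simp only [normalDensity]
  change ENNReal.ofReal (normalConst S' * _) * ENNReal.ofReal (normalConst S * _) =
    ENNReal.ofReal (normalConst (S + S') * _) * ENNReal.ofReal (normalConst (sigmaW S S') * _)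
  rw [← ENNReal.ofReal_mul (mul_nonneg (normalConst_pos hS').le (Real.exp_pos _).le),
    ← ENNReal.ofReal_mul (mul_nonneg (normalConst_pos (hS.add hS')).le (Real.exp_pos _).le),
    mul_mul_mul_comm, mul_mul_mul_comm (normalConst (S + S')), hc, ← Real.exp_add, ← Real.exp_add]
  congr 3
  linarith

end DensityBounds

/-! ### Priors with finite Gaussian averages, and growth of the log-averages -/

section TemperedPrior

variable {d : ℕ} {S S' : Matrix (Fin d) (Fin d) ℝ} {π : EuclideanSpace ℝ (Fin d) → ℝ≥0∞}

/-- A prior density that is measurable, not almost everywhere zero, and integrable against every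
centred isotropic Gaussian weight. -/
structure IsTempered (π : EuclideanSpace ℝ (Fin d) → ℝ≥0∞) : Prop where
  measurable : Measurable π
  not_ae_zero : ¬ π =ᵐ[volume] 0
  lintegral_ne_top : ∀ ε : ℝ, 0 < ε →
    ∫⁻ ν, ENNReal.ofReal (Real.exp (-(ε * ‖ν‖ ^ 2))) * π ν ≠ ∞

theorem IsTempered.lintegral_ne_zero (hπ : IsTempered π) (ε : ℝ) :
    ∫⁻ ν, ENNReal.ofReal (Real.exp (-(ε * ‖ν‖ ^ 2))) * π ν ≠ 0 := by
  have hm := hπ.measurable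
  rw [Ne, lintegral_eq_zero_iff (by fun_prop)]
  intro h
  refine hπ.not_ae_zero ?_
  filter_upwards [h] with x hx
  simp only [Pi.zero_apply, mul_eq_zero, ENNReal.ofReal_eq_zero] at hx
  exact hx.resolve_left (not_le.2 (Real.exp_pos _))

theorem exists_ofReal_mul_le_gaussAvg (hS : S.PosDef) (hm : Measurable π) :
    ∃ β : ℝ, 0 < β ∧ ∀ t : ℝ, 0 < t → ∃ k : ℝ, 0 < k ∧ ∀ y : EuclideanSpace ℝ (Fin d),
      ENNReal.ofReal (k * Real.exp (-(β / t * ‖y‖ ^ 2))) *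
        ∫⁻ ν, ENNReal.ofReal (Real.exp (-(β / t * ‖ν‖ ^ 2))) * π ν ≤ gaussAvg (t • S) π y := by
  obtain ⟨β, hβ, h⟩ := exists_le_normalDensity_smul hS
  refine ⟨2 * β, by positivity, fun t ht => ?_⟩
  obtain ⟨k, hk, hle⟩ := h t ht
  refine ⟨k, hk, fun y => ?_⟩
  rw [gaussAvg_eq_lintegral_mul (hS.smul ht) hm, ← lintegral_const_mul _ (by fun_prop)]
  refine lintegral_mono fun ν => ?_
  beta_reduce
  rw [← mul_assoc]
  gcongr
  refine le_trans ?_ (hle y ν)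
  rw [← ENNReal.ofReal_mul (by positivity), mul_assoc, ← Real.exp_add]
  refine ENNReal.ofReal_le_ofReal (mul_le_mul_of_nonneg_left (Real.exp_le_exp.2 ?_) hk.le)
  have h2 : ‖ν - y‖ ^ 2 ≤ 2 * (‖y‖ ^ 2 + ‖ν‖ ^ 2) := by
    have := norm_sub_le ν y
    nlinarith [sq_nonneg (‖y‖ - ‖ν‖), norm_nonneg (ν - y), norm_nonneg y, norm_nonneg ν]
  have h3 : 0 < β / t := by positivity
  have h4 := mul_le_mul_of_nonneg_left h2 h3.le
  have h5 : 2 * β / t = 2 * (β / t) := by ring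
  rw [h5]
  linarith

/-- Averages at a single point for all scales suffice. For a superharmonic prior this is supplied by
one point where it is finite, through the mean inequality. -/
theorem isTempered_of_gaussAvg_ne_top (hS : S.PosDef) (hm : Measurable π)
    (h0 : ¬ π =ᵐ[volume] 0) (y : EuclideanSpace ℝ (Fin d))
    (h : ∀ t : ℝ, 0 < t → gaussAvg (t • S) π y ≠ ∞) : IsTempered π := by
  refine ⟨hm, h0, fun ε hε => ?_⟩
  obtain ⟨β, hβ, hle⟩ := exists_ofReal_mul_le_gaussAvg hS hm
  -- This scale makes the decay rate β / t of the lower bound exactly ε.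
  have ht : 0 < β / ε := by positivity
  obtain ⟨k, hk, hle⟩ := hle (β / ε) ht
  have hβε : β / (β / ε) = ε := by field_simp
  rw [hβε] at hle
  intro htop
  have := hle y
  rw [htop, ENNReal.mul_top (by rw [Ne, ENNReal.ofReal_eq_zero, not_le]; positivity)] at this
  exact h _ ht (top_le_iff.1 this)

theorem IsTempered.gaussAvg_le (hπ : IsTempered π) (hS : S.PosDef) :
    ∃ k α : ℝ, 0 < k ∧ 0 < α ∧ ∀ y : EuclideanSpace ℝ (Fin d),
      gaussAvg S π y ≤ ENNReal.ofReal (k * Real.exp (α * ‖y‖ ^ 2)) *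
        ∫⁻ ν, ENNReal.ofReal (Real.exp (-(α / 2 * ‖ν‖ ^ 2))) * π ν := by
  obtain ⟨k, α, hk, hα, hle⟩ := exists_normalDensity_le hS
  have hm := hπ.measurable
  refine ⟨k, α, hk, hα, fun y => ?_⟩
  rw [gaussAvg_eq_lintegral_mul hS hm, ← lintegral_const_mul _ (by fun_prop)]
  refine lintegral_mono fun ν => ?_
  beta_reduce
  rw [← mul_assoc]
  gcongr
  refine (hle y ν).trans ?_
  rw [← ENNReal.ofReal_mul (by positivity), mul_assoc, ← Real.exp_add]
  refine ENNReal.ofReal_le_ofReal (mul_le_mul_of_nonneg_left (Real.exp_le_exp.2 ?_) hk.le)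
  have h2 : ‖ν‖ ^ 2 ≤ 2 * (‖y‖ ^ 2 + ‖ν - y‖ ^ 2) := by
    have := norm_add_le (ν - y) y
    rw [sub_add_cancel] at this
    nlinarith [sq_nonneg (‖y‖ - ‖ν - y‖), norm_nonneg (ν - y), norm_nonneg y, norm_nonneg ν]
  nlinarith

theorem IsTempered.gaussAvg_ne_top (hπ : IsTempered π) (hS : S.PosDef)
    (y : EuclideanSpace ℝ (Fin d)) : gaussAvg S π y ≠ ∞ := by
  obtain ⟨k, α, hk, hα, hle⟩ := hπ.gaussAvg_le hS
  exact ne_top_of_le_ne_top (ENNReal.mul_ne_top ENNReal.ofReal_ne_top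
    (hπ.lintegral_ne_top _ (by positivity))) (hle y)

theorem IsTempered.le_gaussAvg (hπ : IsTempered π) (hS : S.PosDef) :
    ∃ k β : ℝ, 0 < k ∧ 0 < β ∧ ∀ y : EuclideanSpace ℝ (Fin d),
      ENNReal.ofReal (k * Real.exp (-(β * ‖y‖ ^ 2))) *
        ∫⁻ ν, ENNReal.ofReal (Real.exp (-(β * ‖ν‖ ^ 2))) * π ν ≤ gaussAvg S π y := by
  obtain ⟨β, hβ, hle⟩ := exists_ofReal_mul_le_gaussAvg hS hπ.measurable
  obtain ⟨k, hk, hle⟩ := hle 1 one_pos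
  exact ⟨k, β, hk, hβ, by simpa using hle⟩

theorem IsTempered.gaussAvg_ne_zero (hπ : IsTempered π) (hS : S.PosDef)
    (y : EuclideanSpace ℝ (Fin d)) : gaussAvg S π y ≠ 0 := by
  obtain ⟨k, β, hk, hβ, hle⟩ := hπ.le_gaussAvg hS
  refine (lt_of_lt_of_le ?_ (hle y)).ne'
  refine ENNReal.mul_pos ?_ (hπ.lintegral_ne_zero _)
  rw [Ne, ENNReal.ofReal_eq_zero, not_le]
  positivity

/-- The logarithm of the average of `π` over the normal distribution with covariance `S`. -/
noncomputable def logAvg (S : Matrix (Fin d) (Fin d) ℝ) (π : EuclideanSpace ℝ (Fin d) → ℝ≥0∞)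
    (y : EuclideanSpace ℝ (Fin d)) : ℝ :=
  Real.log (gaussAvg S π y).toReal

/-- The average lies between positive multiples of exp(-β‖y‖²) and exp(α‖y‖²). Quadratic growth of
the logarithm makes every expectation in the risk formula finite. -/
theorem IsTempered.exists_abs_logAvg_le (hπ : IsTempered π) (hS : S.PosDef) :
    ∃ C : ℝ, 0 ≤ C ∧ ∀ y, |logAvg S π y| ≤ C * (1 + ‖y‖ ^ 2) := by
  obtain ⟨k, α, hk, hα, hup⟩ := hπ.gaussAvg_le hS
  obtain ⟨k', β, hk', hβ, hlo⟩ := hπ.le_gaussAvg hS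
  have hI := hπ.lintegral_ne_top (α / 2) (by positivity)
  have hI0 := hπ.lintegral_ne_zero (α / 2)
  have hJ := hπ.lintegral_ne_top β hβ
  have hJ0 := hπ.lintegral_ne_zero β
  set I := ∫⁻ ν, ENNReal.ofReal (Real.exp (-(α / 2 * ‖ν‖ ^ 2))) * π ν
  set J := ∫⁻ ν, ENNReal.ofReal (Real.exp (-(β * ‖ν‖ ^ 2))) * π ν
  have hIr := ENNReal.toReal_pos hI0 hI
  have hJr := ENNReal.toReal_pos hJ0 hJ
  refine ⟨|Real.log (k * I.toReal)| + |Real.log (k' * J.toReal)| + α + β, by positivity,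
    fun y => ?_⟩
  have hpos := ENNReal.toReal_pos (hπ.gaussAvg_ne_zero hS y) (hπ.gaussAvg_ne_top hS y)
  have h1 : logAvg S π y ≤ Real.log (k * I.toReal) + α * ‖y‖ ^ 2 := by
    have h := ENNReal.toReal_mono (ENNReal.mul_ne_top ENNReal.ofReal_ne_top hI) (hup y)
    rw [ENNReal.toReal_mul, ENNReal.toReal_ofReal (by positivity)] at h
    refine (Real.log_le_log hpos h).trans (le_of_eq ?_)
    rw [mul_right_comm, Real.log_mul (by positivity) (by positivity), Real.log_exp]
  have h2 : Real.log (k' * J.toReal) - β * ‖y‖ ^ 2 ≤ logAvg S π y := by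
    have h := ENNReal.toReal_mono (hπ.gaussAvg_ne_top hS y) (hlo y)
    rw [ENNReal.toReal_mul, ENNReal.toReal_ofReal (by positivity)] at h
    refine le_trans (le_of_eq ?_) (Real.log_le_log (by positivity) h)
    rw [mul_right_comm, Real.log_mul (x := k' * J.toReal) (by positivity) (by positivity),
      Real.log_exp, sub_eq_add_neg]
  have a1 := le_abs_self (Real.log (k * I.toReal))
  have a2 := neg_abs_le (Real.log (k' * J.toReal))
  have a3 := abs_nonneg (Real.log (k * I.toReal))
  have a4 := abs_nonneg (Real.log (k' * J.toReal))
  have a5 := sq_nonneg ‖y‖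
  rw [abs_le]
  constructor <;> nlinarith [mul_nonneg a3 a5, mul_nonneg a4 a5]

theorem measurable_logAvg (S : Matrix (Fin d) (Fin d) ℝ) (hπ : Measurable π) :
    Measurable (logAvg S π) :=
  Real.measurable_log.comp (measurable_gaussAvg S hπ).ennreal_toReal

theorem IsTempered.integrable_logAvg (hπ : IsTempered π) (hS : S.PosDef)
    (μ : EuclideanSpace ℝ (Fin d)) (T : Matrix (Fin d) (Fin d) ℝ) :
    Integrable (logAvg S π) (multivariateGaussian μ T) := by
  obtain ⟨C, hC, hle⟩ := hπ.exists_abs_logAvg_le hS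
  refine Integrable.mono' (((integrable_const (1 : ℝ)).add
    (integrable_norm_pow_multivariateGaussian μ T 2)).const_mul C)
    (measurable_logAvg S hπ.measurable).aestronglyMeasurable (ae_of_all _ fun y => hle y)

theorem isTempered_uniformPrior : IsTempered (uniformPrior (d := d)) := by
  refine isTempered_of_gaussAvg_ne_top (S := 1) PosDef.one measurable_const ?_ 0 ?_
  · intro h
    have h2 : ∀ᵐ _ : EuclideanSpace ℝ (Fin d), False := by
      filter_upwards [h] with x hx
      simp [uniformPrior] at hx
    simp only [eventually_false_iff_eq_bot, ae_eq_bot] at h2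
    exact NeZero.ne _ h2
  · intro t _
    unfold uniformPrior
    rw [gaussAvg_const]
    simp

theorem logAvg_uniformPrior (S : Matrix (Fin d) (Fin d) ℝ) (y : EuclideanSpace ℝ (Fin d)) :
    logAvg S uniformPrior y = 0 := by
  unfold logAvg uniformPrior
  rw [gaussAvg_const]
  simp

end TemperedPrior

/-! ### The risk as a difference of expected log-averages -/

section Risk

/-- With everywhere positive finite densities, p/q is the Radon-Nikodym derivative. Nonnegativity of
the integral is kept because `ENNReal.ofReal` would hide it. -/
theorem klDiv_withDensity {α : Type*} [MeasurableSpace α] {ν : Measure α} [SigmaFinite ν]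
    {p q : α → ℝ≥0∞} (hp : Measurable p) (hq : Measurable q) (hq0 : ∀ x, q x ≠ 0)
    (hp0 : ∀ x, p x ≠ 0) (hpt : ∀ x, p x ≠ ∞) (hqt : ∀ x, q x ≠ ∞) (hp1 : ∫⁻ x, p x ∂ν = 1)
    (hq1 : ∫⁻ x, q x ∂ν = 1)
    (hint : Integrable (fun x => Real.log (p x).toReal - Real.log (q x).toReal)
      (ν.withDensity p)) :
    InformationTheory.klDiv (ν.withDensity p) (ν.withDensity q) =
      ENNReal.ofReal (∫ x, (Real.log (p x).toReal - Real.log (q x).toReal) ∂(ν.withDensity p)) ∧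
    0 ≤ ∫ x, (Real.log (p x).toReal - Real.log (q x).toReal) ∂(ν.withDensity p) := by
  have hP : IsProbabilityMeasure (ν.withDensity p) :=
    ⟨by rw [withDensity_apply _ MeasurableSet.univ, setLIntegral_univ, hp1]⟩
  have hQ : IsProbabilityMeasure (ν.withDensity q) :=
    ⟨by rw [withDensity_apply _ MeasurableSet.univ, setLIntegral_univ, hq1]⟩
  have hac : ν.withDensity p ≪ ν.withDensity q :=
    (withDensity_absolutelyContinuous _ _).trans
      (withDensity_absolutelyContinuous' hq.aemeasurable (ae_of_all _ hq0))
  have hPQ : ν.withDensity p = (ν.withDensity q).withDensity (fun x => p x / q x) := by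
    have h := withDensity_mul ν hq (hp.div hq)
    change _ = (ν.withDensity q).withDensity (p / q)
    rw [← h]
    congr 1
    ext x
    exact (ENNReal.mul_div_cancel (hq0 x) (hqt x)).symm
  have hrn : (ν.withDensity p).rnDeriv (ν.withDensity q) =ᵐ[ν.withDensity q]
      fun x => p x / q x := by
    rw [hPQ]
    exact Measure.rnDeriv_withDensity _ (hp.div hq)
  have hllr : llr (ν.withDensity p) (ν.withDensity q) =ᵐ[ν.withDensity p]
      fun x => Real.log (p x).toReal - Real.log (q x).toReal := by
    filter_upwards [hac.ae_le hrn] with x hx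
    rw [llr, hx, ENNReal.toReal_div, Real.log_div]
    · exact (ENNReal.toReal_pos (hp0 x) (hpt x)).ne'
    · exact (ENNReal.toReal_pos (hq0 x) (hqt x)).ne'
  have hint' := hint.congr hllr.symm
  have h1 := InformationTheory.klDiv_of_ac_of_integrable hac hint'
  have h2 := InformationTheory.integral_llr_add_sub_measure_univ_nonneg hac hint'
  simp only [probReal_univ, add_sub_cancel_right, integral_congr_ae hllr] at h1 h2
  exact ⟨h1, h2⟩

variable {d : ℕ} {S S' : Matrix (Fin d) (Fin d) ℝ} {π : EuclideanSpace ℝ (Fin d) → ℝ≥0∞}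

theorem measurable_normalDensity_uncurry (S : Matrix (Fin d) (Fin d) ℝ) :
    Measurable fun p : EuclideanSpace ℝ (Fin d) × EuclideanSpace ℝ (Fin d) =>
      normalDensity p.1 S p.2 := by
  unfold normalDensity
  fun_prop

theorem lintegral_normalDensity (hS : S.PosDef) (μ : EuclideanSpace ℝ (Fin d)) :
    ∫⁻ y, normalDensity μ S y = 1 := by
  have : IsProbabilityMeasure (volume.withDensity (normalDensity μ S)) := by
    rw [← multivariateGaussian_eq_withDensity μ hS]
    infer_instance
  have h := measure_univ (μ := volume.withDensity (normalDensity μ S))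
  rwa [withDensity_apply _ MeasurableSet.univ, setLIntegral_univ] at h

/-- The posterior precision-weighted mean of an observation `y` and a future observation `y'`. -/
noncomputable def pooledMean (S S' : Matrix (Fin d) (Fin d) ℝ) (y y' : EuclideanSpace ℝ (Fin d)) :
    EuclideanSpace ℝ (Fin d) :=
  toEuclideanLin (sigmaW S S' * S⁻¹) y + toEuclideanLin (sigmaW S S' * S'⁻¹) y'

theorem measurable_pooledMean (S S' : Matrix (Fin d) (Fin d) ℝ) :
    Measurable fun p : EuclideanSpace ℝ (Fin d) × EuclideanSpace ℝ (Fin d) =>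
      pooledMean S S' p.1 p.2 := by
  have h1 := (LinearMap.continuous_of_finiteDimensional
    (toEuclideanLin (sigmaW S S' * S⁻¹))).measurable
  have h2 := (LinearMap.continuous_of_finiteDimensional
    (toEuclideanLin (sigmaW S S' * S'⁻¹))).measurable
  exact (h1.comp measurable_fst).add (h2.comp measurable_snd)

/-- The two weights sum to the identity, so the mean stays μ. This is what turns the numerator of
the predictive density into an expectation under N(μ, W). -/
theorem prod_map_pooledMean (hS : S.PosDef) (hS' : S'.PosDef) (μ : EuclideanSpace ℝ (Fin d)) :
    ((multivariateGaussian μ S).prod (multivariateGaussian μ S')).map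
      (fun p => pooledMean S S' p.1 p.2) = multivariateGaussian μ (sigmaW S S') := by
  have h1 := (LinearMap.continuous_of_finiteDimensional
    (toEuclideanLin (sigmaW S S' * S⁻¹))).measurable
  have h2 := (LinearMap.continuous_of_finiteDimensional
    (toEuclideanLin (sigmaW S S' * S'⁻¹))).measurable
  have hp : ∀ {A T : Matrix (Fin d) (Fin d) ℝ}, T.PosDef → (A * T * Aᵀ).PosSemidef := by
    intro A T hT
    simpa [conjTranspose_eq_transpose_of_trivial] using
      hT.posSemidef.mul_mul_conjTranspose_same A
  have h := multivariateGaussian_conv (toEuclideanLin (sigmaW S S' * S⁻¹) μ)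
    (toEuclideanLin (sigmaW S S' * S'⁻¹) μ) (hp (A := sigmaW S S' * S⁻¹) hS)
    (hp (A := sigmaW S S' * S'⁻¹) hS')
  rw [sigmaW_covariance hS hS', ← LinearMap.add_apply, ← map_add, sigmaW_mean hS hS',
    ← multivariateGaussian_map_toEuclideanLin _ _ hS.posSemidef,
    ← multivariateGaussian_map_toEuclideanLin _ _ hS'.posSemidef, Measure.conv,
    Measure.map_prod_map _ _ h1 h2, Measure.map_map (by fun_prop) (h1.prodMap h2)] at h
  have e : toEuclideanLin (1 : Matrix (Fin d) (Fin d) ℝ) μ = μ := by simp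
  rw [e] at h
  exact h

theorem bayesPredictive_eq (hS : S.PosDef) (hS' : S'.PosDef) (hπ : Measurable π)
    (y y' : EuclideanSpace ℝ (Fin d)) :
    bayesPredictive S S' π y y' = normalDensity y (S + S') y' *
      gaussAvg (sigmaW S S') π (pooledMean S S' y y') / gaussAvg S π y := by
  rw [bayesPredictive, gaussAvg_eq_lintegral_mul hS hπ,
    gaussAvg_eq_lintegral_mul (posDef_sigmaW hS hS') hπ,
    ← lintegral_const_mul _ (f := fun z => normalDensity (pooledMean S S' y y') (sigmaW S S') z * π z)
      ((measurable_normalDensity _ _).mul hπ)]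
  congr 1
  · refine lintegral_congr fun ν => ?_
    rw [normalDensity_mul_normalDensity hS hS', mul_assoc]
    rfl
  · exact lintegral_congr fun ν => by rw [normalDensity_symm]

theorem lintegral_bayesPredictive (hS : S.PosDef) (hS' : S'.PosDef) (hπ : IsTempered π)
    (y : EuclideanSpace ℝ (Fin d)) : ∫⁻ y', bayesPredictive S S' π y y' = 1 := by
  have hm := hπ.measurable
  have hN3 : Measurable fun ν => normalDensity ν S y := by
    simp_rw [normalDensity_symm S _ y]
    exact measurable_normalDensity y S
  have hden : ∫⁻ ν, normalDensity ν S y * π ν = gaussAvg S π y := by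
    rw [gaussAvg_eq_lintegral_mul hS hm]
    exact lintegral_congr fun ν => by rw [normalDensity_symm]
  set f : EuclideanSpace ℝ (Fin d) → EuclideanSpace ℝ (Fin d) → ℝ≥0∞ := fun y' ν =>
    normalDensity ν S' y' * normalDensity ν S y * π ν with hf
  have hfm : Measurable (Function.uncurry f) := by
    have h1 : Measurable fun p : EuclideanSpace ℝ (Fin d) × EuclideanSpace ℝ (Fin d) =>
        normalDensity p.2 S' p.1 := by
      have e : (fun p : EuclideanSpace ℝ (Fin d) × EuclideanSpace ℝ (Fin d) =>
          normalDensity p.2 S' p.1) = fun p => normalDensity p.1 S' p.2 :=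
        funext fun p => normalDensity_symm _ _ _
      rw [e]
      exact measurable_normalDensity_uncurry S'
    have h2 : Measurable fun p : EuclideanSpace ℝ (Fin d) × EuclideanSpace ℝ (Fin d) =>
        normalDensity p.2 S y := hN3.comp measurable_snd
    have h3 : Measurable fun p : EuclideanSpace ℝ (Fin d) × EuclideanSpace ℝ (Fin d) => π p.2 :=
      hm.comp measurable_snd
    exact (h1.mul h2).mul h3
  have hbayes : ∀ y', bayesPredictive S S' π y y' = (∫⁻ ν, f y' ν) * (gaussAvg S π y)⁻¹ := by
    intro y'
    rw [bayesPredictive, hden, div_eq_mul_inv]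
  have hinner : ∀ ν, ∫⁻ y', f y' ν = normalDensity ν S y * π ν := by
    intro ν
    simp only [hf, mul_assoc]
    rw [lintegral_mul_const _ (measurable_normalDensity ν S'), lintegral_normalDensity hS', one_mul]
  have hfm' : Measurable fun y' => ∫⁻ ν, f y' ν := hfm.lintegral_prod_right'
  simp_rw [hbayes]
  rw [lintegral_mul_const _ hfm', lintegral_lintegral_swap hfm.aemeasurable]
  simp_rw [hinner]
  rw [hden]
  exact ENNReal.mul_inv_cancel (hπ.gaussAvg_ne_zero hS y) (hπ.gaussAvg_ne_top hS y)

/-- The logarithm of the ratio of the true density to the predictive density of the uniform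
prior. -/
noncomputable def logRatio (S S' : Matrix (Fin d) (Fin d) ℝ) (μ y y' : EuclideanSpace ℝ (Fin d)) :
    ℝ :=
  Real.log (normalDensity μ S' y').toReal - Real.log (normalDensity y (S + S') y').toReal

theorem log_sub_log_bayesPredictive (hS : S.PosDef) (hS' : S'.PosDef) (hπ : IsTempered π)
    (μ y y' : EuclideanSpace ℝ (Fin d)) :
    Real.log (normalDensity μ S' y').toReal - Real.log (bayesPredictive S S' π y y').toReal =
      logRatio S S' μ y y' - logAvg (sigmaW S S') π (pooledMean S S' y y') + logAvg S π y := by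
  have hW := posDef_sigmaW hS hS'
  have h1 := ENNReal.toReal_pos (hπ.gaussAvg_ne_zero hS y) (hπ.gaussAvg_ne_top hS y)
  have h2 := ENNReal.toReal_pos (hπ.gaussAvg_ne_zero hW (pooledMean S S' y y'))
    (hπ.gaussAvg_ne_top hW _)
  have h3 := ENNReal.toReal_pos (normalDensity_pos (hS.add hS') y y').ne'
    (normalDensity_ne_top _ _ _)
  rw [bayesPredictive_eq hS hS' hπ.measurable, ENNReal.toReal_div, ENNReal.toReal_mul,
    Real.log_div (by positivity) h1.ne', Real.log_mul h3.ne' h2.ne', logRatio, logAvg, logAvg]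
  ring

theorem integrable_norm_sq_fst_snd (μ ν : EuclideanSpace ℝ (Fin d))
    (S T : Matrix (Fin d) (Fin d) ℝ) :
    Integrable (fun p : EuclideanSpace ℝ (Fin d) × EuclideanSpace ℝ (Fin d) =>
      1 + ‖p.1‖ ^ 2 + ‖p.2‖ ^ 2) ((multivariateGaussian μ S).prod (multivariateGaussian ν T)) :=
  ((integrable_const _).add ((integrable_norm_pow_multivariateGaussian μ S 2).comp_fst _)).add
    ((integrable_norm_pow_multivariateGaussian ν T 2).comp_snd _)

theorem measurable_logRatio (S S' : Matrix (Fin d) (Fin d) ℝ) (μ : EuclideanSpace ℝ (Fin d)) :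
    Measurable fun p : EuclideanSpace ℝ (Fin d) × EuclideanSpace ℝ (Fin d) =>
      logRatio S S' μ p.1 p.2 := by
  have h1 : Measurable fun p : EuclideanSpace ℝ (Fin d) × EuclideanSpace ℝ (Fin d) =>
      normalDensity μ S' p.2 := (measurable_normalDensity μ S').comp measurable_snd
  exact (Real.measurable_log.comp h1.ennreal_toReal).sub
    (Real.measurable_log.comp (measurable_normalDensity_uncurry (S + S')).ennreal_toReal)

theorem integrable_logRatio (hS : S.PosDef) (hS' : S'.PosDef) (μ : EuclideanSpace ℝ (Fin d)) :
    Integrable (fun p : EuclideanSpace ℝ (Fin d) × EuclideanSpace ℝ (Fin d) =>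
      logRatio S S' μ p.1 p.2) ((multivariateGaussian μ S).prod (multivariateGaussian μ S')) := by
  obtain ⟨C₁, hC₁, h₁⟩ := exists_abs_log_normalDensity_le hS'
  obtain ⟨C₂, hC₂, h₂⟩ := exists_abs_log_normalDensity_le (hS.add hS')
  refine ((integrable_norm_sq_fst_snd μ μ S S').const_mul (C₁ * (1 + ‖μ‖ ^ 2) + C₂)).mono'
    (measurable_logRatio S S' μ).aestronglyMeasurable (ae_of_all _ fun p => ?_)
  rw [Real.norm_eq_abs, logRatio]
  refine (abs_sub _ _).trans ?_
  have a := h₁ μ p.2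
  have b := h₂ p.1 p.2
  have c := sq_nonneg ‖μ‖
  have c1 := sq_nonneg ‖p.1‖
  have c2 := sq_nonneg ‖p.2‖
  have e : C₁ * (1 + ‖μ‖ ^ 2 + ‖p.2‖ ^ 2) ≤ C₁ * ((1 + ‖μ‖ ^ 2) * (1 + ‖p.1‖ ^ 2 + ‖p.2‖ ^ 2)) :=
    mul_le_mul_of_nonneg_left (by nlinarith [mul_nonneg c c1, mul_nonneg c c2]) hC₁
  linarith

theorem integrable_logAvg_pooledMean (hS : S.PosDef) (hS' : S'.PosDef) (hπ : IsTempered π)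
    (μ : EuclideanSpace ℝ (Fin d)) :
    Integrable (fun p : EuclideanSpace ℝ (Fin d) × EuclideanSpace ℝ (Fin d) =>
      logAvg (sigmaW S S') π (pooledMean S S' p.1 p.2))
      ((multivariateGaussian μ S).prod (multivariateGaussian μ S')) := by
  have h := hπ.integrable_logAvg (posDef_sigmaW hS hS') μ (sigmaW S S')
  rw [← prod_map_pooledMean hS hS' μ] at h
  exact (integrable_map_measure h.1 (measurable_pooledMean S S').aemeasurable).1 h

/-- The Kullback-Leibler risk of a Bayesian predictive density in terms of the expected logarithms
of the two marginal densities. -/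
theorem klRisk_bayesPredictive (hS : S.PosDef) (hS' : S'.PosDef) (hπ : IsTempered π)
    (μ : EuclideanSpace ℝ (Fin d)) :
    klRisk S S' (bayesPredictive S S' π) μ = ENNReal.ofReal
      (∫ p, logRatio S S' μ p.1 p.2 ∂((multivariateGaussian μ S).prod (multivariateGaussian μ S')) -
        ∫ z, logAvg (sigmaW S S') π z ∂(multivariateGaussian μ (sigmaW S S')) +
        ∫ y, logAvg S π y ∂(multivariateGaussian μ S)) ∧
    0 ≤ ∫ p, logRatio S S' μ p.1 p.2
        ∂((multivariateGaussian μ S).prod (multivariateGaussian μ S')) -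
      ∫ z, logAvg (sigmaW S S') π z ∂(multivariateGaussian μ (sigmaW S S')) +
      ∫ y, logAvg S π y ∂(multivariateGaussian μ S) := by
  have hW := posDef_sigmaW hS hS'
  set ρ := (multivariateGaussian μ S).prod (multivariateGaussian μ S') with hρ
  set F : EuclideanSpace ℝ (Fin d) → EuclideanSpace ℝ (Fin d) → ℝ := fun y y' =>
    logRatio S S' μ y y' - logAvg (sigmaW S S') π (pooledMean S S' y y') + logAvg S π y with hF
  have i1 := integrable_logRatio hS hS' μ
  have i2 := integrable_logAvg_pooledMean hS hS' hπ μ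
  have i3 : Integrable (fun p : EuclideanSpace ℝ (Fin d) × EuclideanSpace ℝ (Fin d) =>
      logAvg S π p.1) ρ := (hπ.integrable_logAvg hS μ S).comp_fst _
  have i12 : Integrable (fun p : EuclideanSpace ℝ (Fin d) × EuclideanSpace ℝ (Fin d) =>
      logRatio S S' μ p.1 p.2 - logAvg (sigmaW S S') π (pooledMean S S' p.1 p.2)) ρ := i1.sub i2
  have hFint : Integrable (fun p : EuclideanSpace ℝ (Fin d) × EuclideanSpace ℝ (Fin d) =>
      F p.1 p.2) ρ := i12.add i3
  have hFm : Measurable (fun p : EuclideanSpace ℝ (Fin d) × EuclideanSpace ℝ (Fin d) =>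
      F p.1 p.2) := by
    have h1 := (measurable_logAvg (sigmaW S S') hπ.measurable).comp (measurable_pooledMean S S')
    have h2 : Measurable fun p : EuclideanSpace ℝ (Fin d) × EuclideanSpace ℝ (Fin d) =>
        logAvg S π p.1 := (measurable_logAvg S hπ.measurable).comp measurable_fst
    exact ((measurable_logRatio S S' μ).sub h1).add h2
  have htotal : ∫ p, F p.1 p.2 ∂ρ = ∫ p, logRatio S S' μ p.1 p.2 ∂ρ -
      ∫ z, logAvg (sigmaW S S') π z ∂(multivariateGaussian μ (sigmaW S S')) +
      ∫ y, logAvg S π y ∂(multivariateGaussian μ S) := by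
    have e1 : ∫ z, logAvg (sigmaW S S') π z ∂(multivariateGaussian μ (sigmaW S S')) =
        ∫ p, logAvg (sigmaW S S') π (pooledMean S S' p.1 p.2) ∂ρ := by
      rw [← prod_map_pooledMean hS hS' μ, integral_map (measurable_pooledMean S S').aemeasurable]
      exact (measurable_logAvg _ hπ.measurable).aestronglyMeasurable
    have e2 : ∫ y, logAvg S π y ∂(multivariateGaussian μ S) = ∫ p, logAvg S π p.1 ∂ρ := by
      rw [hρ, integral_fun_fst]
      simp
    rw [e1, e2, ← integral_sub i1 i2, ← integral_add i12 i3]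
  -- Fubini would give this for almost every y only; the formula for the loss below is wanted at
  -- every y.
  have hsec : ∀ y, Integrable (F y) (multivariateGaussian μ S') := by
    intro y
    obtain ⟨C₁, hC₁, h₁⟩ := exists_abs_log_normalDensity_le hS'
    obtain ⟨C₂, hC₂, h₂⟩ := exists_abs_log_normalDensity_le (hS.add hS')
    have j1 : Integrable (fun y' => logRatio S S' μ y y') (multivariateGaussian μ S') := by
      have hsum : ∀ a : ℝ, Integrable (fun y' : EuclideanSpace ℝ (Fin d) => 1 + a + ‖y'‖ ^ 2)
          (multivariateGaussian μ S') := fun a =>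
        (integrable_const _).add (integrable_norm_pow_multivariateGaussian μ S' 2)
      refine (((hsum (‖μ‖ ^ 2)).const_mul C₁).add ((hsum (‖y‖ ^ 2)).const_mul C₂)).mono'
        ((measurable_logRatio S S' μ).comp measurable_prodMk_left).aestronglyMeasurable
        (ae_of_all _ fun y' => ?_)
      exact (abs_sub _ _).trans (add_le_add (h₁ μ y') (h₂ y y'))
    obtain ⟨C, hC, hle⟩ := hπ.exists_abs_logAvg_le hW
    have j2 : Integrable (fun y' => logAvg (sigmaW S S') π (pooledMean S S' y y'))
        (multivariateGaussian μ S') := by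
      have hg : MemLp (fun y' => pooledMean S S' y y') 2 (multivariateGaussian μ S') := by
        have hlin := (LinearMap.toContinuousLinearMap
          (toEuclideanLin (sigmaW S S' * S'⁻¹))).comp_memLp'
          (IsGaussian.memLp_two_id (μ := multivariateGaussian μ S'))
        exact (memLp_const (toEuclideanLin (sigmaW S S' * S⁻¹) y)).add hlin
      have hg2 := hg.integrable_norm_pow (by norm_num)
      refine (((integrable_const (1 : ℝ)).add hg2).const_mul C).mono'
        (((measurable_logAvg _ hπ.measurable).comp
          ((measurable_pooledMean S S').comp measurable_prodMk_left)).aestronglyMeasurable)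
        (ae_of_all _ fun y' => ?_)
      simpa using hle (pooledMean S S' y y')
    exact (j1.sub j2).add (integrable_const _)
  have hkl : ∀ y, klLoss (normalDensity μ S') (bayesPredictive S S' π y) =
      ENNReal.ofReal (∫ y', F y y' ∂(multivariateGaussian μ S')) ∧
      0 ≤ ∫ y', F y y' ∂(multivariateGaussian μ S') := by
    intro y
    have hbm : Measurable (bayesPredictive S S' π y) := by
      have h1 : bayesPredictive S S' π y = fun y' => normalDensity y (S + S') y' *
          gaussAvg (sigmaW S S') π (pooledMean S S' y y') / gaussAvg S π y :=
        funext fun y' => bayesPredictive_eq hS hS' hπ.measurable y y'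
      rw [h1]
      exact ((measurable_normalDensity y _).mul ((measurable_gaussAvg _ hπ.measurable).comp
        ((measurable_pooledMean S S').comp measurable_prodMk_left))).div_const _
    have hF' : ∀ y', F y y' = Real.log (normalDensity μ S' y').toReal -
        Real.log (bayesPredictive S S' π y y').toReal := fun y' =>
      (log_sub_log_bayesPredictive hS hS' hπ μ y y').symm
    have hint := hsec y
    simp only [hF', multivariateGaussian_eq_withDensity μ hS'] at hint ⊢
    have hint' := hint.congr (ae_of_all _ hF')
    refine klDiv_withDensity (measurable_normalDensity μ S') hbm (fun y' => ?_)
      (fun y' => (normalDensity_pos hS' μ y').ne') (fun y' => normalDensity_ne_top _ _ _)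
      (fun y' => ?_) (lintegral_normalDensity hS' μ) (lintegral_bayesPredictive hS hS' hπ y) hint'
    · rw [bayesPredictive_eq hS hS' hπ.measurable]
      exact (ENNReal.div_pos (mul_ne_zero (normalDensity_pos (hS.add hS') y y').ne'
        (hπ.gaussAvg_ne_zero hW _)) (hπ.gaussAvg_ne_top hS y)).ne'
    · rw [bayesPredictive_eq hS hS' hπ.measurable]
      exact ENNReal.div_ne_top (ENNReal.mul_ne_top (normalDensity_ne_top _ _ _)
        (hπ.gaussAvg_ne_top hW _)) (hπ.gaussAvg_ne_zero hS y)
  have hG : Integrable (fun y => ∫ y', F y y' ∂(multivariateGaussian μ S'))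
      (multivariateGaussian μ S) := hFint.integral_prod_left
  rw [← htotal, hρ, integral_prod _ hFint]
  refine ⟨?_, integral_nonneg fun y => (hkl y).2⟩
  rw [ofReal_integral_eq_lintegral_ofReal hG (ae_of_all _ fun y => (hkl y).2), klRisk]
  simp only [fun y => (hkl y).1]
  have hGm : Measurable fun y => ∫ y', F y y' ∂(multivariateGaussian μ S') :=
    (StronglyMeasurable.integral_prod_right' (f := fun p : _ × _ => F p.1 p.2)
      hFm.stronglyMeasurable).measurable
  rw [multivariateGaussian_eq_withDensity μ hS,
    lintegral_withDensity_eq_lintegral_mul _ (measurable_normalDensity μ S) hGm.ennreal_ofReal]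
  rfl

end Risk

/-! ### Comparison of the log-averages and the equality case -/

section Comparison

variable {d : ℕ} {S W B : Matrix (Fin d) (Fin d) ℝ} {π : EuclideanSpace ℝ (Fin d) → ℝ≥0∞}

theorem prod_map_add (μ : EuclideanSpace ℝ (Fin d)) (hW : W.PosDef) (hB : B.PosDef) :
    ((multivariateGaussian μ W).prod (multivariateGaussian 0 B)).map (fun p => p.1 + p.2) =
      multivariateGaussian μ (W + B) := by
  have h := multivariateGaussian_conv μ 0 hW.posSemidef hB.posSemidef
  rw [add_zero] at h
  exact h

/-- Integrate over the increment first: since B + (W + B) = W + 2B, the inner mean of the numerator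
is the W-average of the 2B-average of π, which is at most the denominator. -/
theorem lintegral_gaussAvg_div_le (hW : W.PosDef) (hB : B.PosDef) (hπ : IsTempered π)
    (hsup : ∀ t : ℝ, 0 < t → ∀ x, gaussAvg (t • B) π x ≤ π x) (μ : EuclideanSpace ℝ (Fin d)) :
    ∫⁻ p, gaussAvg (W + B) π (p.1 + p.2) / gaussAvg W π p.1
      ∂((multivariateGaussian μ W).prod (multivariateGaussian 0 B)) ≤ 1 := by
  have hm := measurable_gaussAvg (W + B) hπ.measurable
  have hw := measurable_gaussAvg W hπ.measurable
  have h1 : Measurable fun p : EuclideanSpace ℝ (Fin d) × EuclideanSpace ℝ (Fin d) =>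
      gaussAvg (W + B) π (p.1 + p.2) := hm.comp (measurable_fst.add measurable_snd)
  have h2 : Measurable fun p : EuclideanSpace ℝ (Fin d) × EuclideanSpace ℝ (Fin d) =>
      gaussAvg W π p.1 := hw.comp measurable_fst
  have h3 : Measurable fun p : EuclideanSpace ℝ (Fin d) × EuclideanSpace ℝ (Fin d) =>
      gaussAvg (W + B) π (p.1 + p.2) / gaussAvg W π p.1 := h1.div h2
  rw [lintegral_prod _ h3.aemeasurable]
  have hle : ∀ z, ∫⁻ ξ, gaussAvg (W + B) π (z + ξ) / gaussAvg W π z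
      ∂(multivariateGaussian 0 B) ≤ 1 := by
    intro z
    simp_rw [div_eq_mul_inv]
    have hz : Measurable fun ξ => gaussAvg (W + B) π (z + ξ) :=
      hm.comp (measurable_const_add z)
    rw [lintegral_mul_const _ hz]
    change gaussAvg B (gaussAvg (W + B) π) z * _ ≤ 1
    have e : gaussAvg B (gaussAvg (W + B) π) = gaussAvg W (gaussAvg ((2 : ℝ) • B) π) := by
      rw [gaussAvg_gaussAvg hB.posSemidef (hW.add hB).posSemidef hπ.measurable,
        gaussAvg_gaussAvg hW.posSemidef (hB.smul two_pos).posSemidef hπ.measurable]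
      congr 1
      rw [two_smul]
      abel
    rw [e, ← div_eq_mul_inv]
    exact ENNReal.div_le_of_le_mul (by rw [one_mul]; exact gaussAvg_mono W (hsup 2 two_pos) z)
  exact (lintegral_mono hle).trans (by simp)

/-- For the ratio t of mean at most 1, the function t - 1 - log t is nonnegative and vanishes only
at t = 1. Its integral gives the inequality, and the vanishing of that integral the equality case.
-/
theorem logAvg_comparison (hW : W.PosDef) (hB : B.PosDef) (hπ : IsTempered π)
    (hsup : ∀ t : ℝ, 0 < t → ∀ x, gaussAvg (t • B) π x ≤ π x) (μ : EuclideanSpace ℝ (Fin d)) :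
    ∫ y, logAvg (W + B) π y ∂(multivariateGaussian μ (W + B)) ≤
      ∫ z, logAvg W π z ∂(multivariateGaussian μ W) ∧
    (∫ z, logAvg W π z ∂(multivariateGaussian μ W) ≤
        ∫ y, logAvg (W + B) π y ∂(multivariateGaussian μ (W + B)) →
      ∀ᵐ p ∂((multivariateGaussian μ W).prod (multivariateGaussian 0 B)),
        gaussAvg (W + B) π (p.1 + p.2) = gaussAvg W π p.1) := by
  have hS := hW.add hB
  set ρ := (multivariateGaussian μ W).prod (multivariateGaussian 0 B) with hρ
  have hm := measurable_gaussAvg (W + B) hπ.measurable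
  have hw := measurable_gaussAvg W hπ.measurable
  have mpos : ∀ y, 0 < (gaussAvg (W + B) π y).toReal := fun y =>
    ENNReal.toReal_pos (hπ.gaussAvg_ne_zero hS y) (hπ.gaussAvg_ne_top hS y)
  have wpos : ∀ y, 0 < (gaussAvg W π y).toReal := fun y =>
    ENNReal.toReal_pos (hπ.gaussAvg_ne_zero hW y) (hπ.gaussAvg_ne_top hW y)
  set t : EuclideanSpace ℝ (Fin d) × EuclideanSpace ℝ (Fin d) → ℝ := fun p =>
    (gaussAvg (W + B) π (p.1 + p.2) / gaussAvg W π p.1).toReal with ht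
  have h1 : Measurable fun p : EuclideanSpace ℝ (Fin d) × EuclideanSpace ℝ (Fin d) =>
      gaussAvg (W + B) π (p.1 + p.2) := hm.comp (measurable_fst.add measurable_snd)
  have h2 : Measurable fun p : EuclideanSpace ℝ (Fin d) × EuclideanSpace ℝ (Fin d) =>
      gaussAvg W π p.1 := hw.comp measurable_fst
  have h3 : Measurable fun p : EuclideanSpace ℝ (Fin d) × EuclideanSpace ℝ (Fin d) =>
      gaussAvg (W + B) π (p.1 + p.2) / gaussAvg W π p.1 := h1.div h2
  have hlin := lintegral_gaussAvg_div_le hW hB hπ hsup μ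
  rw [← hρ] at hlin
  have htint : Integrable t ρ :=
    integrable_toReal_of_lintegral_ne_top h3.aemeasurable
      (ne_top_of_le_ne_top ENNReal.one_ne_top hlin)
  have htle : ∫ p, t p ∂ρ ≤ 1 := by
    rw [integral_toReal h3.aemeasurable
      (ae_lt_top h3 (ne_top_of_le_ne_top ENNReal.one_ne_top hlin))]
    exact ENNReal.toReal_le_of_le_ofReal zero_le_one (by simpa using hlin)
  have tpos : ∀ p, 0 < t p := by
    intro p
    rw [ht]
    simp only [ENNReal.toReal_div]
    exact div_pos (mpos _) (wpos _)
  have hlog : ∀ p, Real.log (t p) = logAvg (W + B) π (p.1 + p.2) - logAvg W π p.1 := by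
    intro p
    rw [ht]
    simp only [ENNReal.toReal_div]
    rw [Real.log_div (mpos _).ne' (wpos _).ne']
    rfl
  have i1 : Integrable (fun p => logAvg (W + B) π (p.1 + p.2)) ρ := by
    have h := hπ.integrable_logAvg hS μ (W + B)
    rw [← prod_map_add μ hW hB] at h
    exact (integrable_map_measure h.1 (by fun_prop)).1 h
  have i2 : Integrable (fun p : EuclideanSpace ℝ (Fin d) × EuclideanSpace ℝ (Fin d) =>
      logAvg W π p.1) ρ := (hπ.integrable_logAvg hW μ W).comp_fst _
  have e1 : ∫ p, logAvg (W + B) π (p.1 + p.2) ∂ρ =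
      ∫ y, logAvg (W + B) π y ∂(multivariateGaussian μ (W + B)) := by
    rw [← prod_map_add μ hW hB, integral_map (by fun_prop)]
    exact (measurable_logAvg _ hπ.measurable).aestronglyMeasurable
  have e2 : ∫ p, logAvg W π p.1 ∂ρ = ∫ z, logAvg W π z ∂(multivariateGaussian μ W) := by
    rw [hρ, integral_fun_fst]
    simp
  have i3 : Integrable (fun p => Real.log (t p)) ρ := by
    simp_rw [hlog]
    exact i1.sub i2
  have e3 : ∫ p, Real.log (t p) ∂ρ =
      ∫ y, logAvg (W + B) π y ∂(multivariateGaussian μ (W + B)) -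
        ∫ z, logAvg W π z ∂(multivariateGaussian μ W) := by
    simp_rw [hlog]
    rw [integral_sub i1 i2, e1, e2]
  have i4 : Integrable (fun p => t p - 1) ρ := htint.sub (integrable_const _)
  have i5 : Integrable (fun p => t p - 1 - Real.log (t p)) ρ := i4.sub i3
  have e4 : ∫ p, (t p - 1 - Real.log (t p)) ∂ρ = ∫ p, t p ∂ρ - 1 - ∫ p, Real.log (t p) ∂ρ := by
    rw [integral_sub i4 i3, integral_sub htint (integrable_const _)]
    simp
  have hnn : ∀ p, 0 ≤ t p - 1 - Real.log (t p) := fun p =>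
    sub_nonneg.2 (Real.log_le_sub_one_of_pos (tpos p))
  have hnn' : 0 ≤ ∫ p, (t p - 1 - Real.log (t p)) ∂ρ := integral_nonneg hnn
  refine ⟨by linarith, fun hle => ?_⟩
  have hzero : ∫ p, (t p - 1 - Real.log (t p)) ∂ρ = 0 := le_antisymm (by linarith) hnn'
  rw [integral_eq_zero_iff_of_nonneg hnn i5] at hzero
  filter_upwards [hzero] with p hp
  have ht1 : t p = 1 := by
    by_contra hne
    have := Real.log_lt_sub_one_of_pos (tpos p) hne
    simp only [Pi.zero_apply] at hp
    linarith
  rw [ht] at ht1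
  simp only [ENNReal.toReal_div] at ht1
  rw [div_eq_one_iff_eq (wpos _).ne'] at ht1
  exact (ENNReal.toReal_eq_toReal_iff' (hπ.gaussAvg_ne_top hS _) (hπ.gaussAvg_ne_top hW _)).1 ht1

theorem ae_volume_eq_of_ae_add (hB : B.PosDef) {g : EuclideanSpace ℝ (Fin d) → ℝ≥0∞}
    (hg : Measurable g) {z : EuclideanSpace ℝ (Fin d)} {c : ℝ≥0∞}
    (h : ∀ᵐ ξ ∂(multivariateGaussian 0 B), g (z + ξ) = c) : ∀ᵐ y, g y = c := by
  refine (volume_absolutelyContinuous_multivariateGaussian z hB).ae_le ?_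
  rw [multivariateGaussian_eq_map_const_add]
  exact (ae_map_iff (by fun_prop) (hg (measurableSet_singleton c))).2 h

/-- For almost every z the law of z + ξ is equivalent to Lebesgue measure, so the (W + B)-average
equals the number `gaussAvg W π z` almost everywhere. Two such z must give the same number. -/
theorem exists_ae_eq_const_of_ae_prod (hW : W.PosDef) (hB : B.PosDef) (hπ : IsTempered π)
    (μ : EuclideanSpace ℝ (Fin d))
    (h : ∀ᵐ p ∂((multivariateGaussian μ W).prod (multivariateGaussian 0 B)),
        gaussAvg (W + B) π (p.1 + p.2) = gaussAvg W π p.1) :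
    ∃ c : ℝ≥0∞, c ≠ ∞ ∧ (∀ᵐ y, gaussAvg (W + B) π y = c) ∧ ∀ᵐ y, gaussAvg W π y = c := by
  have hm := measurable_gaussAvg (W + B) hπ.measurable
  have h2 : ∀ᵐ z ∂(multivariateGaussian μ W), ∀ᵐ y, gaussAvg (W + B) π y = gaussAvg W π z := by
    filter_upwards [Measure.ae_ae_of_ae_prod h] with z hz
    exact ae_volume_eq_of_ae_add hB hm hz
  obtain ⟨z₀, hz₀⟩ := h2.exists
  refine ⟨gaussAvg W π z₀, hπ.gaussAvg_ne_top hW z₀, hz₀, ?_⟩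
  filter_upwards [(volume_absolutelyContinuous_multivariateGaussian μ hW).ae_le h2] with z hz
  obtain ⟨y, hy1, hy2⟩ := (hz.and hz₀).exists
  rw [← hy1, hy2]

theorem exists_nat_smul_sub_posDef (hB : B.PosDef) (hS : S.PosDef) :
    ∃ n : ℕ, 0 < n ∧ ((n : ℝ) • B - S).PosDef := by
  obtain ⟨α, hα, hαB⟩ := exists_le_quadratic hB
  obtain ⟨β, hβ, hβS⟩ := exists_quadratic_le S
  obtain ⟨n, hn⟩ := exists_nat_gt (β / α)
  have hn0 : (0 : ℝ) < n := lt_trans (by positivity) hn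
  refine ⟨n, by exact_mod_cast hn0, PosDef.of_dotProduct_mulVec_pos
    ((hB.smul hn0).isHermitian.sub hS.isHermitian) fun x hx => ?_⟩
  have h1 := hαB (WithLp.toLp 2 x)
  have h2 := hβS (WithLp.toLp 2 x)
  have h3 : 0 < ‖WithLp.toLp 2 x‖ ^ 2 := by
    have : WithLp.toLp 2 x ≠ 0 := by simpa using hx
    positivity
  rw [div_lt_iff₀ hα] at hn
  simp only [star_trivial, sub_mulVec, dotProduct_sub, smul_mulVec, dotProduct_smul, smul_eq_mul]
  simp only at h1 h2
  have h4 := mul_le_mul_of_nonneg_left h1 hn0.le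
  have h5 := mul_lt_mul_of_pos_right hn h3
  linarith

/-- The W-averages of π and of its B-average agree at a point and are finite there, while one
integrand lies below the other; so π is almost everywhere B-invariant, hence nB-invariant. Once nB
exceeds W + B, the nB-average factors through a function almost everywhere equal to c. -/
theorem exists_eq_const_of_gaussAvg_ae_const (hW : W.PosDef) (hB : B.PosDef)
    (hlsc : LowerSemicontinuous π) (hsup : ∀ x, gaussAvg B π x ≤ π x) {c : ℝ≥0∞} (hc : c ≠ ∞)
    (h₁ : ∀ᵐ y, gaussAvg (W + B) π y = c) (h₂ : ∀ᵐ y, gaussAvg W π y = c) : ∀ x, π x = c := by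
  have hπ : Measurable π := hlsc.measurable
  have hS := hW.add hB
  have hBπ := measurable_gaussAvg B hπ
  obtain ⟨x, hx1, hx2⟩ := (h₁.and h₂).exists
  rw [← gaussAvg_gaussAvg hW.posSemidef hB.posSemidef hπ, gaussAvg_eq_lintegral W hBπ] at hx1
  rw [gaussAvg_eq_lintegral W hπ] at hx2
  have hinv : gaussAvg B π =ᵐ[volume] π := by
    refine (volume_absolutelyContinuous_multivariateGaussian x hW).ae_le ?_
    exact ae_eq_of_ae_le_of_lintegral_le (ae_of_all _ hsup) (by rw [hx1]; exact hc)
      hπ.aemeasurable (by rw [hx1, hx2])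
  have hiter : ∀ n : ℕ, 0 < n → gaussAvg ((n : ℝ) • B) π =ᵐ[volume] π := by
    intro n hn
    induction n, hn using Nat.le_induction with
    | base => simpa using hinv
    | succ n hn ih =>
      have hn' : (0 : ℝ) < n := by exact_mod_cast hn
      have e : (((n + 1 : ℕ) : ℝ) • B) = (n : ℝ) • B + B := by
        push_cast
        rw [add_smul, one_smul]
      rw [e, ← gaussAvg_gaussAvg (hB.smul hn').posSemidef hB.posSemidef hπ,
        gaussAvg_congr_ae (hB.smul hn') hBπ hπ hinv]
      exact ih
  obtain ⟨n, hn, hpd⟩ := exists_nat_smul_sub_posDef hB hS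
  have hae : π =ᵐ[volume] fun _ => c := by
    refine (hiter n hn).symm.trans ?_
    have e : (n : ℝ) • B = ((n : ℝ) • B - (W + B)) + (W + B) := by abel
    rw [e, ← gaussAvg_gaussAvg hpd.posSemidef hS.posSemidef hπ,
      gaussAvg_congr_ae hpd (measurable_gaussAvg _ hπ) measurable_const h₁]
    exact ae_of_all _ fun y => gaussAvg_const _ _ _
  intro y
  refine le_antisymm ?_ ?_
  -- By lower semicontinuity {π > c} is open, and it is null, hence empty. The reverse bound is the
  -- mean inequality at y.
  · by_contra hlt
    rw [not_le] at hlt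
    have hopen := hlsc.isOpen_preimage c
    have hpos := hopen.measure_pos volume ⟨y, hlt⟩
    refine hpos.ne' (measure_mono_null (fun z hz => ?_) (ae_iff.1 hae))
    exact ne_of_gt hz
  · refine le_trans (le_of_eq ?_) (hsup y)
    rw [gaussAvg_congr_ae hB hπ measurable_const hae, gaussAvg_const]

theorem lowerSemicontinuous_of_isSuperharmonicOn {g : EuclideanSpace ℝ (Fin d) → ℝ≥0∞}
    (hg : IsSuperharmonicOn (fun x => (g x : EReal)) Set.univ) : LowerSemicontinuous g := by
  intro x c hc
  have h := lowerSemicontinuousOn_univ_iff.1 hg.lowerSemicontinuousOn x (c : EReal)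
    (EReal.coe_ennreal_lt_coe_ennreal_iff.2 hc)
  filter_upwards [h] with z hz
  exact EReal.coe_ennreal_lt_coe_ennreal_iff.1 hz

theorem lowerSemicontinuous_of_comp_toEuclideanLin {A : Matrix (Fin d) (Fin d) ℝ}
    (hA : IsUnit A.det) (h : LowerSemicontinuous fun x => π (toEuclideanLin A x)) :
    LowerSemicontinuous π := by
  have e : π = (fun x => π (toEuclideanLin A x)) ∘ toEuclideanLin A⁻¹ := by
    ext x
    simp only [Function.comp_apply, toLpLin_apply, mulVec_mulVec, mul_nonsing_inv _ hA, one_mulVec,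
      WithLp.toLp_ofLp]
  rw [e]
  exact h.comp (LinearMap.continuous_of_finiteDimensional _)

/-- The change of variables by A carries N(0, tI) to N(0, t A Aᵀ), and A is onto. -/
theorem gaussAvg_smul_le_of_isSuperharmonicOn {A : Matrix (Fin d) (Fin d) ℝ} (hA : IsUnit A.det)
    (h : IsSuperharmonicOn (fun x => (π (toEuclideanLin A x) : EReal)) Set.univ) {t : ℝ}
    (ht : 0 < t) (x : EuclideanSpace ℝ (Fin d)) : gaussAvg (t • (A * Aᵀ)) π x ≤ π x := by
  have hlsc := lowerSemicontinuous_of_isSuperharmonicOn h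
  have hπ := (lowerSemicontinuous_of_comp_toEuclideanLin hA hlsc).measurable
  have hx : toEuclideanLin A (toEuclideanLin A⁻¹ x) = x := by
    simp only [toLpLin_apply, mulVec_mulVec, mul_nonsing_inv _ hA, one_mulVec, WithLp.toLp_ofLp]
  have h1 := gaussAvg_le_of_isSuperharmonicOn h hlsc ht (toEuclideanLin A⁻¹ x)
  rw [gaussAvg_comp_toEuclideanLin A (posSemidef_smul_one ht.le) hπ, hx] at h1
  simpa using h1

end Comparison

end NormalPrediction

/-! ### The domination theorem -/

theorem theorem3 {d : ℕ} (S S' : Matrix (Fin d) (Fin d) ℝ) (hS : S.PosDef) (hS' : S'.PosDef)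
    (U : Matrix (Fin d) (Fin d) ℝ) (lam : Fin d → ℝ)
    (hU : NormalPrediction.IsDiagonalization (NormalPrediction.sigmaW S S') S U lam)
    (π : EuclideanSpace ℝ (Fin d) → ℝ≥0∞) (hπ : ∃ μ, π μ ≠ 0)
    (hsuper : NormalPrediction.IsSuperharmonicOn
      (fun μ => ((π (Matrix.toEuclideanLin
        (NormalPrediction.aStar (NormalPrediction.sigmaW S S') U lam) μ) : ℝ≥0∞) : EReal))
      Set.univ) :
    (∀ μ : EuclideanSpace ℝ (Fin d),
      NormalPrediction.klRisk S S' (NormalPrediction.bayesPredictive S S' π) μ ≤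
        NormalPrediction.klRisk S S'
          (NormalPrediction.bayesPredictive S S' NormalPrediction.uniformPrior) μ) ∧
    ((¬ ∃ c : ℝ≥0∞, ∀ μ, π μ = c) →
      NormalPrediction.Dominates S S' (NormalPrediction.bayesPredictive S S' π)
        (NormalPrediction.bayesPredictive S S' NormalPrediction.uniformPrior)) := by
  open NormalPrediction in
  have hAA := aStar_mul_transpose hS hS' hU
  have hW := posDef_sigmaW hS hS'
  have hB := posDef_sub_sigmaW hS hS'
  set W := sigmaW S S' with hWdef
  set A := aStar W U lam
  set B := S - W with hBdef
  have hWB : W + B = S := by rw [hBdef]; abel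
  have hA : IsUnit A.det := by
    have : IsUnit (A.det * Aᵀ.det) := by
      rw [← Matrix.det_mul, hAA]
      exact posDef_det_isUnit hB
    exact isUnit_of_mul_isUnit_left this
  have hsup : ∀ t : ℝ, 0 < t → ∀ x, gaussAvg (t • B) π x ≤ π x := by
    intro t ht x
    rw [← hAA]
    exact gaussAvg_smul_le_of_isSuperharmonicOn hA hsuper ht x
  have hlsc : LowerSemicontinuous π := lowerSemicontinuous_of_comp_toEuclideanLin hA
    (lowerSemicontinuous_of_isSuperharmonicOn hsuper)
  have htemp : IsTempered π := by
    obtain ⟨y, _, hy⟩ := hsuper.not_top_on_component 0 (Set.mem_univ 0)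
    have hy' : π (Matrix.toEuclideanLin A y) ≠ ∞ := by
      intro h
      exact hy (by rw [h]; rfl)
    refine isTempered_of_gaussAvg_ne_top hB hlsc.measurable ?_ (Matrix.toEuclideanLin A y)
      fun t ht => ne_top_of_le_ne_top hy' (hsup t ht _)
    -- The set {π > 0} is open and nonempty, so it has positive measure.
    intro h0
    obtain ⟨μ, hμ⟩ := hπ
    have hopen := hlsc.isOpen_preimage 0
    have hpos := hopen.measure_pos MeasureTheory.volume ⟨μ, pos_iff_ne_zero.2 hμ⟩
    refine hpos.ne' (MeasureTheory.measure_mono_null (fun z hz => ?_) (MeasureTheory.ae_iff.1 h0))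
    exact ne_of_gt hz
  have hcomp := logAvg_comparison hW hB htemp hsup
  rw [hWB] at hcomp
  have hmono : ∀ μ, klRisk S S' (bayesPredictive S S' π) μ ≤
      klRisk S S' (bayesPredictive S S' uniformPrior) μ := by
    intro μ
    rw [(klRisk_bayesPredictive hS hS' htemp μ).1,
      (klRisk_bayesPredictive hS hS' isTempered_uniformPrior μ).1]
    refine ENNReal.ofReal_le_ofReal ?_
    simp only [logAvg_uniformPrior, MeasureTheory.integral_zero]
    linarith [(hcomp μ).1]
  refine ⟨hmono, fun hconst => ⟨hmono, 0, ?_⟩⟩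
  have hnonneg := (klRisk_bayesPredictive hS hS' htemp 0).2
  rw [(klRisk_bayesPredictive hS hS' htemp 0).1,
    (klRisk_bayesPredictive hS hS' isTempered_uniformPrior 0).1]
  simp only [logAvg_uniformPrior, MeasureTheory.integral_zero]
  -- Strictness survives `ENNReal.ofReal` because the smaller real expression is known to be
  -- nonnegative.
  rw [ENNReal.ofReal_lt_ofReal_iff_of_nonneg hnonneg]
  by_contra hle
  rw [not_lt] at hle
  have hae := (hcomp 0).2 (by linarith)
  rw [← hWB] at hae
  obtain ⟨c, hc, h₁, h₂⟩ := exists_ae_eq_const_of_ae_prod hW hB htemp 0 hae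
  exact hconst ⟨c, exists_eq_const_of_gaussAvg_ae_const hW hB hlsc
    (by simpa using hsup 1 one_pos) hc h₁ h₂⟩
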